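/- Let $\mathbb{D}$ be the open unit disc with the hyperbolic metric $2|dz|/(1-|z|^2)$. A subset $E\subset\mathbb{D}$ is called hyperbolically convex if for all $z,w\in E$ the hyperbolic geodesic segment joining $z$ to $w$ is contained in $E$. For $X\subset\mathbb{C}$ let $\Lambda_1(X,\sigma)$ denote the one-dimensional Hausdorff measure of $X$ with respect to the spherical metric $\sigma$, i.e. the metric of $2|dz|/(1+|z|^2)$, and let $\partial E$ denote the boundary of $E$ in $\mathbb{C}$. **Lemma.** For every hyperbolically convex subset $E$ of $\mathbb{D}$, $$\Lambda_1(\partial E,\sigma) < \pi^2 .$$ Moreover $\pi^2$ is approached precisely in the following sense, with $\mathbb{D}$ as the limiting extremal set: 1. If $(E_n)$ is a sequence of hyperbolically convex subsets of $\mathbb{D}$ with $\Lambda_1(\partial E_n,\sigma)\to\pi^2$, then $E_n\to\mathbb{D}$, i.e. every compact subset of $\mathbb{D}$ is contained in $E_n$ for all sufficiently large $n$. 2. There is a sequence $(E_n)$ of hyperbolically convex subsets of $\mathbb{D}$ with $\Lambda_1(\partial E_n,\sigma)\to\pi^2$. -/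

import Mathlib

open scoped Topology ComplexConjugate

noncomputable section

/-- The distance on the unit disc of the hyperbolic metric `2|dz|/(1-|z|²)`. -/
def hypDist (z w : ℂ) : ℝ :=
  2 * Real.artanh (‖z - w‖ / ‖1 - conj z * w‖)

/-- The hyperbolic geodesic segment joining two points `z`, `w` of the unit disc: the points `p` of
the disc that lie between `z` and `w` for the hyperbolic distance. -/
def hypSegment (z w : ℂ) : Set ℂ :=
  {p | p ∈ Metric.ball (0 : ℂ) 1 ∧ hypDist z p + hypDist p w = hypDist z w}

/-- Hyperbolically convex subsets of the unit disc. -/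
def IsHypConvex (E : Set ℂ) : Prop :=
  E ⊆ Metric.ball (0 : ℂ) 1 ∧ ∀ z ∈ E, ∀ w ∈ E, hypSegment z w ⊆ E

/-- The distance on `ℂ`, as a subset of the Riemann sphere, of the spherical metric
`2|dz|/(1+|z|²)`: the great-circle distance of the stereographic images of `z` and `w`
on the unit sphere, whose chordal distance is `2 ‖z - w‖ / √((1 + ‖z‖²) (1 + ‖w‖²))`. -/
def sphDist (z w : ℂ) : ℝ :=
  2 * Real.arcsin (‖z - w‖ / (√(1 + ‖z‖ ^ 2) * √(1 + ‖w‖ ^ 2)))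

/-- Inverse stereographic projection from `ℂ` to the unit sphere of `ℂ × ℝ`. -/
def stereoLift (z : ℂ) : WithLp 2 (ℂ × ℝ) :=
  WithLp.toLp 2 ((2 / (1 + ‖z‖ ^ 2) : ℝ) • z, (1 - ‖z‖ ^ 2) / (1 + ‖z‖ ^ 2))

theorem stereoLift_norm (z : ℂ) : ‖stereoLift z‖ = 1 := by
  have h : (0 : ℝ) < 1 + ‖z‖ ^ 2 := by positivity
  have : ‖stereoLift z‖ ^ 2 = 1 := by
    rw [WithLp.prod_norm_sq_eq_of_L2]
    change ‖(2 / (1 + ‖z‖ ^ 2) : ℝ) • z‖ ^ 2 + ‖(1 - ‖z‖ ^ 2) / (1 + ‖z‖ ^ 2)‖ ^ 2 = 1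
    simp only [norm_smul, Real.norm_eq_abs, mul_pow, sq_abs]
    field_simp
    ring
  nlinarith [norm_nonneg (stereoLift z)]

theorem stereoLift_inner (z w : ℂ) : inner ℝ (stereoLift z) (stereoLift w) =
    1 - 2 * (‖z - w‖ / (√(1 + ‖z‖ ^ 2) * √(1 + ‖w‖ ^ 2))) ^ 2 := by
  have hz : (0 : ℝ) < 1 + ‖z‖ ^ 2 := by positivity
  have hw : (0 : ℝ) < 1 + ‖w‖ ^ 2 := by positivity
  rw [WithLp.prod_inner_apply, div_pow, mul_pow, Real.sq_sqrt hz.le, Real.sq_sqrt hw.le,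
    @norm_sub_sq_real]
  simp only [stereoLift, inner_smul_left, inner_smul_right, RCLike.inner_apply, conj_trivial]
  field_simp
  ring

theorem sphDist_eq_angle (z w : ℂ) :
    sphDist z w = InnerProductGeometry.angle (stereoLift z) (stereoLift w) := by
  have hi := stereoLift_inner z w
  rw [InnerProductGeometry.angle, stereoLift_norm, stereoLift_norm, hi, sphDist]
  have hb := real_inner_le_norm (-stereoLift z) (stereoLift w)
  rw [inner_neg_left, norm_neg, stereoLift_norm, stereoLift_norm, hi] at hb
  have h0 : 0 ≤ ‖z - w‖ / (√(1 + ‖z‖ ^ 2) * √(1 + ‖w‖ ^ 2)) := by positivity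
  set s := ‖z - w‖ / (√(1 + ‖z‖ ^ 2) * √(1 + ‖w‖ ^ 2))
  have h1 : s ≤ 1 := by nlinarith
  have hc : Real.cos (2 * Real.arcsin s) = 1 - 2 * s ^ 2 := by
    rw [Real.cos_two_mul, Real.cos_sq', Real.sin_arcsin (by linarith) h1]
    ring
  have e : (1 - 2 * s ^ 2) / (1 * 1) = Real.cos (2 * Real.arcsin s) := by rw [hc]; ring
  rw [e, Real.arccos_cos]
  · have := Real.arcsin_nonneg.2 h0
    linarith
  · have := Real.arcsin_le_pi_div_two s
    linarith

theorem sphDist_eq_zero {z w : ℂ} (h : sphDist z w = 0) : z = w := by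
  have h2 : Real.arcsin (‖z - w‖ / (√(1 + ‖z‖ ^ 2) * √(1 + ‖w‖ ^ 2))) = 0 := by
    unfold sphDist at h
    linarith
  rw [Real.arcsin_eq_zero_iff, div_eq_zero_iff] at h2
  have hp : √(1 + ‖z‖ ^ 2) * √(1 + ‖w‖ ^ 2) ≠ 0 := by positivity
  exact sub_eq_zero.1 (norm_eq_zero.1 (h2.resolve_right hp))

/-- The complex plane, to be given the spherical metric `2|dz|/(1+|z|²)`. -/
structure SphericalPlane : Type where
  toComplex : ℂ

instance : MetricSpace SphericalPlane where
  dist z w := sphDist z.toComplex w.toComplex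
  dist_self z := by simp [sphDist]
  dist_comm z w := by
    rw [sphDist_eq_angle, sphDist_eq_angle, InnerProductGeometry.angle_comm]
  dist_triangle x y z := by
    simp only [sphDist_eq_angle]
    exact InnerProductGeometry.angle_le_angle_add_angle _ _ _
  eq_of_dist_eq_zero {z w} h := by
    cases z
    cases w
    exact congrArg _ (sphDist_eq_zero h)

instance : MeasurableSpace SphericalPlane := borel SphericalPlane

instance : BorelSpace SphericalPlane := ⟨rfl⟩

/-- The spherical length of a set `X`: its one-dimensional Hausdorff measure with respect to the
spherical metric. -/
def sphLength (X : Set ℂ) : ENNReal :=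
  MeasureTheory.Measure.hausdorffMeasure 1 (SphericalPlane.mk '' X)

end

/-! The stereographic lift of `z` is `(kleinMap z, kleinHeight z)`, so `kleinMap` is the lift
followed by vertical projection of the hemisphere onto the disc. It turns hyperbolic geodesics into
straight chords (`mem_hypSegment_iff`), hence hyperbolically convex sets into planar convex sets,
while a chord at distance `p` from the origin lifts to a semicircle of radius `√(1 - p²)` on the
sphere.

Upper bound: `chordArc x ψ` is the arc length position of `x` on the semicircle above the chord
through `x` normal to `e^{iψ}`. As `ψ` turns with `x` fixed, its derivative is at least `-(π/2)
max(p, 0)`, where `p` is the normal coordinate (`hasDerivAt_chordArc_lower`). Adding `π/2` times the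
integral of a majorant `q` of the support function therefore gives an increasing quantity,
`turnedArc`. To compare two boundary points, turn the supporting line of the first to the direction
of the chord joining them, slide along the chord, and turn on to the supporting line of the second;
the spherical distance is at most the growth of `turnedArc` (`sphDist_le_turnedArc_sub`). The
boundary thus embeds in the line by an expanding map, and one full turn gives length at most `π/2 *
∫ q` (`IsHypConvex.sphLength_frontier_le`). For `q = 1` this is `π²`.

Strictness and convergence: a set that misses a point of Klein norm at most `r < 1` lies in a
half-plane at distance `r`, so `q` drops below `1` near one direction, and the bound is less than
`π²` and depends only on `r`. The full disc has boundary length only `2π`.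

Sharpness: the ideal regular `n`-gon has `n` sides lifting to semicircles of radius `sin (π/n)`, of
total length `n π sin (π/n) → π²`. -/

/-! ### The Klein map and its inverse. -/

/-- The Klein model map `z ↦ 2z/(1+|z|²)`. -/
noncomputable def kleinMap (z : ℂ) : ℂ := (2 / (1 + ‖z‖ ^ 2) : ℝ) • z

/-- The height of the stereographic lift of `z`. -/
noncomputable def kleinHeight (z : ℂ) : ℝ := (1 - ‖z‖ ^ 2) / (1 + ‖z‖ ^ 2)

theorem norm_sq_eq_re_im (z : ℂ) : ‖z‖ ^ 2 = z.re ^ 2 + z.im ^ 2 := by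
  rw [Complex.sq_norm, Complex.normSq_apply]; ring

theorem kleinMap_re (z : ℂ) : (kleinMap z).re = 2 * z.re / (1 + ‖z‖ ^ 2) := by
  simp [kleinMap, Complex.real_smul, -Complex.ofReal_div]; ring

theorem kleinMap_im (z : ℂ) : (kleinMap z).im = 2 * z.im / (1 + ‖z‖ ^ 2) := by
  simp [kleinMap, Complex.real_smul, -Complex.ofReal_div]; ring

/-- This says that the lift `(kleinMap z, kleinHeight z)` lies on the unit sphere. -/
theorem kleinHeight_sq (z : ℂ) :
    kleinHeight z ^ 2 = 1 - ((kleinMap z).re ^ 2 + (kleinMap z).im ^ 2) := by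
  have h : (0 : ℝ) < 1 + ‖z‖ ^ 2 := by positivity
  rw [kleinMap_re, kleinMap_im, kleinHeight]
  field_simp
  linear_combination (-4) * norm_sq_eq_re_im z

theorem continuous_kleinMap : Continuous kleinMap := by
  have h : Continuous fun z : ℂ => (2 / (1 + ‖z‖ ^ 2) : ℝ) :=
    continuous_const.div (by fun_prop) fun z => by positivity
  exact h.smul continuous_id

theorem kleinHeight_pos {z : ℂ} (hz : ‖z‖ < 1) : 0 < kleinHeight z := by
  unfold kleinHeight
  have : ‖z‖ ^ 2 < 1 := by nlinarith [norm_nonneg z]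
  exact div_pos (by linarith) (by positivity)

theorem kleinHeight_nonneg {z : ℂ} (hz : ‖z‖ ≤ 1) : 0 ≤ kleinHeight z := by
  unfold kleinHeight
  have : ‖z‖ ^ 2 ≤ 1 := by nlinarith [norm_nonneg z]
  exact div_nonneg (by linarith) (by positivity)

theorem norm_kleinMap_lt_one {z : ℂ} (hz : ‖z‖ < 1) : ‖kleinMap z‖ < 1 := by
  have h1 := kleinHeight_sq z
  have h2 := kleinHeight_pos hz
  rw [← norm_sq_eq_re_im] at h1
  nlinarith [norm_nonneg (kleinMap z)]

theorem norm_kleinMap_le_one (z : ℂ) : ‖kleinMap z‖ ≤ 1 := by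
  have h1 := kleinHeight_sq z
  rw [← norm_sq_eq_re_im] at h1
  nlinarith [norm_nonneg (kleinMap z), sq_nonneg (kleinHeight z)]

/-- The inverse of the Klein map on the closed disc. -/
noncomputable def kleinInv (x : ℂ) : ℂ := (1 / (1 + √(1 - ‖x‖ ^ 2)) : ℝ) • x

theorem kleinInv_kleinMap {z : ℂ} (hz : ‖z‖ ≤ 1) : kleinInv (kleinMap z) = z := by
  have h1 : √(1 - ‖kleinMap z‖ ^ 2) = kleinHeight z := by
    rw [norm_sq_eq_re_im, ← kleinHeight_sq, Real.sqrt_sq (kleinHeight_nonneg hz)]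
  rw [kleinInv, h1, kleinMap, smul_smul]
  have h : (0 : ℝ) < 1 + ‖z‖ ^ 2 := by positivity
  have : 1 / (1 + kleinHeight z) * (2 / (1 + ‖z‖ ^ 2)) = 1 := by
    unfold kleinHeight
    have : 1 + (1 - ‖z‖ ^ 2) / (1 + ‖z‖ ^ 2) = 2 / (1 + ‖z‖ ^ 2) := by field_simp; ring
    rw [this]
    field_simp
  rw [this, one_smul]

theorem kleinInv_norm_sq {x : ℂ} (hx : ‖x‖ ≤ 1) :
    ‖kleinInv x‖ ^ 2 = (1 - √(1 - ‖x‖ ^ 2)) / (1 + √(1 - ‖x‖ ^ 2)) := by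
  have h0 : 0 ≤ 1 - ‖x‖ ^ 2 := by nlinarith [norm_nonneg x]
  have h1 := Real.sqrt_nonneg (1 - ‖x‖ ^ 2)
  have h2 := Real.sq_sqrt h0
  rw [kleinInv, norm_smul, mul_pow, Real.norm_eq_abs, sq_abs]
  set h := √(1 - ‖x‖ ^ 2)
  rw [show ‖x‖ ^ 2 = (1 - h) * (1 + h) by linarith]
  field_simp

theorem kleinMap_kleinInv {x : ℂ} (hx : ‖x‖ ≤ 1) : kleinMap (kleinInv x) = x := by
  have h1 := Real.sqrt_nonneg (1 - ‖x‖ ^ 2)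
  rw [kleinMap, kleinInv_norm_sq hx, kleinInv, smul_smul]
  set h := √(1 - ‖x‖ ^ 2)
  have : 2 / (1 + (1 - h) / (1 + h)) * (1 / (1 + h)) = 1 := by
    have : 1 + (1 - h) / (1 + h) = 2 / (1 + h) := by field_simp; ring
    rw [this]
    field_simp
  rw [this, one_smul]

theorem norm_kleinInv_lt_one {x : ℂ} (hx : ‖x‖ < 1) : ‖kleinInv x‖ < 1 := by
  have h0 : 0 < 1 - ‖x‖ ^ 2 := by nlinarith [norm_nonneg x]
  have h1 := Real.sqrt_pos.2 h0
  have h2 := kleinInv_norm_sq hx.le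
  have : (1 - √(1 - ‖x‖ ^ 2)) / (1 + √(1 - ‖x‖ ^ 2)) < 1 := by
    rw [div_lt_one (by positivity)]; linarith
  nlinarith [norm_nonneg (kleinInv x)]

/-! ### Hyperbolic convexity becomes Euclidean convexity. -/

/-- Hyperboloid model: `(1, kleinMap z)` has Lorentz norm `kleinHeight z`, and `cosh` of the
distance is the normalized Lorentz product. -/
theorem cosh_hypDist {z w : ℂ} (hz : ‖z‖ < 1) (hw : ‖w‖ < 1) :
    Real.cosh (hypDist z w) * (kleinHeight z * kleinHeight w) =
      1 - ((kleinMap z).re * (kleinMap w).re + (kleinMap z).im * (kleinMap w).im) := by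
  have hz2 : ‖z‖ ^ 2 < 1 := by nlinarith [norm_nonneg z]
  have hw2 : ‖w‖ ^ 2 < 1 := by nlinarith [norm_nonneg w]
  have e1 : ‖z - w‖ ^ 2 = ‖z‖ ^ 2 + ‖w‖ ^ 2 - 2 * (z.re * w.re + z.im * w.im) := by
    simp only [norm_sq_eq_re_im, Complex.sub_re, Complex.sub_im]; ring
  have e2 : ‖1 - conj z * w‖ ^ 2 = 1 + ‖z‖ ^ 2 * ‖w‖ ^ 2 - 2 * (z.re * w.re + z.im * w.im) := by
    simp only [norm_sq_eq_re_im, Complex.sub_re, Complex.sub_im, Complex.mul_re, Complex.mul_im,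
      Complex.conj_re, Complex.conj_im, Complex.one_re, Complex.one_im]; ring
  have e3 : ‖1 - conj z * w‖ ^ 2 - ‖z - w‖ ^ 2 = (1 - ‖z‖ ^ 2) * (1 - ‖w‖ ^ 2) := by
    rw [e1, e2]; ring
  have hp : 0 < (1 - ‖z‖ ^ 2) * (1 - ‖w‖ ^ 2) := mul_pos (by linarith) (by linarith)
  have h4 : 0 < ‖1 - conj z * w‖ ^ 2 := by nlinarith [sq_nonneg ‖z - w‖]
  have h5 : 0 < ‖1 - conj z * w‖ := by
    rcases (norm_nonneg (1 - conj z * w)).eq_or_lt with h | h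
    · rw [← h] at h4; norm_num at h4
    · exact h
  have hx : ‖z - w‖ / ‖1 - conj z * w‖ ∈ Set.Ioo (-1 : ℝ) 1 := by
    refine ⟨lt_of_lt_of_le (by norm_num) (by positivity : (0 : ℝ) ≤ _), ?_⟩
    rw [div_lt_one h5]
    nlinarith [norm_nonneg (z - w)]
  have hx2 : (‖z - w‖ / ‖1 - conj z * w‖) ^ 2 = ‖z - w‖ ^ 2 / ‖1 - conj z * w‖ ^ 2 := div_pow _ _ _
  have hx3 : 1 - ‖z - w‖ ^ 2 / ‖1 - conj z * w‖ ^ 2 =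
      (1 - ‖z‖ ^ 2) * (1 - ‖w‖ ^ 2) / ‖1 - conj z * w‖ ^ 2 := by
    rw [← e3, sub_div, div_self h4.ne']
  have hc : Real.cosh (hypDist z w) = 2 * (‖1 - conj z * w‖ ^ 2 /
      ((1 - ‖z‖ ^ 2) * (1 - ‖w‖ ^ 2))) - 1 := by
    rw [hypDist, Real.cosh_two_mul, Real.sinh_sq, Real.cosh_artanh hx, hx2, hx3, div_pow,
      Real.sq_sqrt (by positivity)]
    field_simp
    ring
  rw [hc, kleinMap_re, kleinMap_re, kleinMap_im, kleinMap_im, kleinHeight, kleinHeight, e2]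
  have : 1 - ‖z‖ ^ 2 ≠ 0 := by linarith
  have : 1 - ‖w‖ ^ 2 ≠ 0 := by linarith
  field_simp
  ring

theorem hypDist_nonneg (z w : ℂ) : 0 ≤ hypDist z w := by
  unfold hypDist
  have := Real.artanh_nonneg (x := ‖z - w‖ / ‖1 - conj z * w‖) (by positivity)
  linarith

/-- Makes betweenness algebraic: the square removes `sinh` from the addition formula, and the
inequality selects the sign of the root. -/
theorem add_eq_iff_cosh {a b d : ℝ} (ha : 0 ≤ a) (hb : 0 ≤ b) (hd : 0 ≤ d) :
    a + b = d ↔ Real.cosh a * Real.cosh b ≤ Real.cosh d ∧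
      (Real.cosh d - Real.cosh a * Real.cosh b) ^ 2 =
        (Real.cosh a ^ 2 - 1) * (Real.cosh b ^ 2 - 1) := by
  have h1 : Real.cosh a ^ 2 - 1 = Real.sinh a ^ 2 := by rw [Real.sinh_sq]
  have h2 : Real.cosh b ^ 2 - 1 = Real.sinh b ^ 2 := by rw [Real.sinh_sq]
  have h3 : 0 ≤ Real.sinh a * Real.sinh b :=
    mul_nonneg (Real.sinh_nonneg_iff.2 ha) (Real.sinh_nonneg_iff.2 hb)
  rw [h1, h2, ← mul_pow]
  constructor
  · rintro rfl
    rw [Real.cosh_add]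
    exact ⟨by linarith, by ring⟩
  · rintro ⟨h4, h5⟩
    have h6 := (pow_left_inj₀ (by linarith) h3 two_ne_zero).1 h5
    have h7 : Real.cosh d = Real.cosh (a + b) := by rw [Real.cosh_add]; linarith
    have h8 := Real.cosh_le_cosh.1 h7.le
    have h9 := Real.cosh_le_cosh.1 h7.ge
    rw [abs_of_nonneg hd, abs_of_nonneg (add_nonneg ha hb)] at h8 h9
    linarith

/-- Points of the open disc on a chord, in terms of the Lorentz form `1 - x·y`. -/
theorem mem_segment_iff_lorentz {x y p : ℂ} (hx : ‖x‖ < 1) (hxy : x ≠ y) :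
    p ∈ segment ℝ x y ↔
      (1 - (x.re * p.re + x.im * p.im)) * (1 - (p.re * y.re + p.im * y.im)) ≤
        (1 - (x.re * y.re + x.im * y.im)) * (1 - (p.re ^ 2 + p.im ^ 2)) ∧
      (p.re - x.re) * (y.im - x.im) - (p.im - x.im) * (y.re - x.re) = 0 := by
  have hx2 : x.re ^ 2 + x.im ^ 2 < 1 := by
    rw [← norm_sq_eq_re_im]; nlinarith [norm_nonneg x]
  have hd : 0 < (y.re - x.re) ^ 2 + (y.im - x.im) ^ 2 := by
    have : 0 < ‖y - x‖ ^ 2 := by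
      have := norm_pos_iff.2 (sub_ne_zero.2 hxy.symm); positivity
    rwa [norm_sq_eq_re_im] at this
  set u := y.re - x.re with hu
  set v := y.im - x.im with hv
  have hyr : y.re = x.re + u := by rw [hu]; ring
  have hyi : y.im = x.im + v := by rw [hv]; ring
  have hK : 0 < (u ^ 2 + v ^ 2) - (x.re * v - x.im * u) ^ 2 := by
    nlinarith [sq_nonneg (x.re * u + x.im * v)]
  -- The two Lorentz products at parameter `l` on the line differ by `l (1 - l)` times a positive
  -- constant, so the inequality detects exactly `l ∈ [0, 1]`.
  have key : ∀ l : ℝ, (1 - (x.re * (x.re + l * u) + x.im * (x.im + l * v))) *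
      (1 - ((x.re + l * u) * y.re + (x.im + l * v) * y.im)) +
      l * (1 - l) * ((u ^ 2 + v ^ 2) - (x.re * v - x.im * u) ^ 2) =
        (1 - (x.re * y.re + x.im * y.im)) * (1 - ((x.re + l * u) ^ 2 + (x.im + l * v) ^ 2)) := by
    intro l
    rw [hyr, hyi]; ring
  rw [segment_eq_image']
  constructor
  · rintro ⟨l, hl, rfl⟩
    have hr : (x + l • (y - x)).re = x.re + l * u := by simp [hu]
    have hi : (x + l • (y - x)).im = x.im + l * v := by simp [hv]
    rw [hr, hi]
    refine ⟨?_, by ring⟩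
    rw [← key l]
    have := mul_nonneg (mul_nonneg hl.1 (sub_nonneg.2 hl.2)) hK.le
    linarith
  · rintro ⟨h1, h2⟩
    set l := ((p.re - x.re) * u + (p.im - x.im) * v) / (u ^ 2 + v ^ 2) with hl
    have hr : p.re = x.re + l * u := by
      rw [hl]; field_simp; linear_combination v * h2
    have hi : p.im = x.im + l * v := by
      rw [hl]; field_simp; linear_combination (-u) * h2
    have h3 := key l
    rw [← hr, ← hi] at h3
    have h4 : 0 ≤ l * (1 - l) := by
      by_contra hneg
      push Not at hneg
      nlinarith [mul_neg_of_neg_of_pos hneg hK]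
    refine ⟨l, ⟨by nlinarith, by nlinarith⟩, ?_⟩
    apply Complex.ext
    · simp [hr, hu]
    · simp [hi, hv]

theorem mem_hypSegment_iff {z w p : ℂ} (hz : ‖z‖ < 1) (hw : ‖w‖ < 1) (hp : ‖p‖ < 1) :
    p ∈ hypSegment z w ↔ kleinMap p ∈ segment ℝ (kleinMap z) (kleinMap w) := by
  have hz' := kleinHeight_pos hz
  have hw' := kleinHeight_pos hw
  have hp' := kleinHeight_pos hp
  have ha := cosh_hypDist hz hp
  have hb := cosh_hypDist hp hw
  have hd := cosh_hypDist hz hw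
  have hpp := kleinHeight_sq p
  have hzz := kleinHeight_sq z
  have hww := kleinHeight_sq w
  have hmem : p ∈ hypSegment z w ↔ hypDist z p + hypDist p w = hypDist z w := by
    simp [hypSegment, hp]
  rw [hmem]
  by_cases hzw : kleinMap z = kleinMap w
  · have e : z = w := by
      rw [← kleinInv_kleinMap hz.le, hzw, kleinInv_kleinMap hw.le]
    subst e
    rw [segment_same, Set.mem_singleton_iff]
    constructor
    · intro h
      have h0 : hypDist z z = 0 := by simp [hypDist]
      have h1 : hypDist z p = 0 := by
        have := hypDist_nonneg z p
        have := hypDist_nonneg p z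
        linarith
      rw [h1, Real.cosh_zero, one_mul] at ha
      have h2 : kleinHeight z ^ 2 + kleinHeight p ^ 2 - 2 * (kleinHeight z * kleinHeight p) +
        ((kleinMap p).re - (kleinMap z).re) ^ 2 + ((kleinMap p).im - (kleinMap z).im) ^ 2 = 0 := by
        rw [ha, hpp, hzz]; ring
      have h3 : ((kleinMap p).re - (kleinMap z).re) ^ 2 = 0 := by
        nlinarith [sq_nonneg (kleinHeight z - kleinHeight p),
          sq_nonneg ((kleinMap p).re - (kleinMap z).re),
          sq_nonneg ((kleinMap p).im - (kleinMap z).im)]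
      have h4 : ((kleinMap p).im - (kleinMap z).im) ^ 2 = 0 := by
        nlinarith [sq_nonneg (kleinHeight z - kleinHeight p),
          sq_nonneg ((kleinMap p).re - (kleinMap z).re),
          sq_nonneg ((kleinMap p).im - (kleinMap z).im)]
      exact Complex.ext (sub_eq_zero.1 (pow_eq_zero_iff two_ne_zero |>.1 h3))
        (sub_eq_zero.1 (pow_eq_zero_iff two_ne_zero |>.1 h4))
    · intro h
      have e : p = z := by
        rw [← kleinInv_kleinMap hz.le, ← h, kleinInv_kleinMap hp.le]
      simp [e, hypDist]
  · rw [mem_segment_iff_lorentz (norm_kleinMap_lt_one hz) hzw,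
      add_eq_iff_cosh (hypDist_nonneg _ _) (hypDist_nonneg _ _) (hypDist_nonneg _ _),
      ← ha, ← hb, ← hd, ← hpp]
    set A := Real.cosh (hypDist z p)
    set B := Real.cosh (hypDist p w)
    set D := Real.cosh (hypDist z w)
    set x := kleinMap z
    set y := kleinMap w
    set q := kleinMap p
    have i1 : A * (kleinHeight z * kleinHeight p) * (B * (kleinHeight p * kleinHeight w)) ≤
        D * (kleinHeight z * kleinHeight w) * kleinHeight p ^ 2 ↔ A * B ≤ D := by
      rw [show A * (kleinHeight z * kleinHeight p) * (B * (kleinHeight p * kleinHeight w)) =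
        A * B * (kleinHeight z * kleinHeight w * kleinHeight p ^ 2) by ring, mul_assoc D,
        mul_le_mul_iff_left₀ (by positivity)]
    -- The left side is the Lorentz Gram determinant of `(1, x)`, `(1, y)`, `(1, q)`. It equals the
    -- squared determinant of these vectors, which vanishes exactly for collinear points.
    have i2 : ((A ^ 2 - 1) * (B ^ 2 - 1) - (D - A * B) ^ 2) *
        (kleinHeight z * kleinHeight w * kleinHeight p) ^ 2 =
        ((q.re - x.re) * (y.im - x.im) - (q.im - x.im) * (y.re - x.re)) ^ 2 := by
      have : ((A ^ 2 - 1) * (B ^ 2 - 1) - (D - A * B) ^ 2) *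
          (kleinHeight z * kleinHeight w * kleinHeight p) ^ 2 =
          kleinHeight z ^ 2 * kleinHeight w ^ 2 * kleinHeight p ^ 2
          + 2 * ((A * (kleinHeight z * kleinHeight p)) * (B * (kleinHeight p * kleinHeight w)) *
            (D * (kleinHeight z * kleinHeight w)))
          - (A * (kleinHeight z * kleinHeight p)) ^ 2 * kleinHeight w ^ 2
          - (B * (kleinHeight p * kleinHeight w)) ^ 2 * kleinHeight z ^ 2
          - (D * (kleinHeight z * kleinHeight w)) ^ 2 * kleinHeight p ^ 2 := by ring
      rw [this, ha, hb, hd, hpp, hzz, hww]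
      ring
    rw [i1]
    refine and_congr_right fun _ => ?_
    have hne : (kleinHeight z * kleinHeight w * kleinHeight p) ^ 2 ≠ 0 := by positivity
    constructor
    · intro h
      rw [← h, sub_self, zero_mul] at i2
      exact pow_eq_zero_iff two_ne_zero |>.1 i2.symm
    · intro h
      rw [h, zero_pow two_ne_zero] at i2
      have := (mul_eq_zero.1 i2).resolve_right hne
      linarith

theorem IsHypConvex.convex_image {E : Set ℂ} (hE : IsHypConvex E) : Convex ℝ (kleinMap '' E) := by
  rw [convex_iff_segment_subset]
  rintro _ ⟨z, hz, rfl⟩ _ ⟨w, hw, rfl⟩ x hx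
  have hz' := mem_ball_zero_iff.1 (hE.1 hz)
  have hw' := mem_ball_zero_iff.1 (hE.1 hw)
  have hx' : ‖x‖ < 1 := mem_ball_zero_iff.1 ((convex_ball (0 : ℂ) 1).segment_subset
    (mem_ball_zero_iff.2 (norm_kleinMap_lt_one hz'))
    (mem_ball_zero_iff.2 (norm_kleinMap_lt_one hw')) hx)
  refine ⟨kleinInv x, hE.2 z hz w hw ?_, kleinMap_kleinInv hx'.le⟩
  rw [mem_hypSegment_iff hz' hw' (norm_kleinInv_lt_one hx'), kleinMap_kleinInv hx'.le]
  exact hx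

theorem isHypConvex_preimage {C : Set ℂ} (hC : Convex ℝ C) :
    IsHypConvex (Metric.ball 0 1 ∩ kleinMap ⁻¹' C) := by
  refine ⟨Set.inter_subset_left, fun z hz w hw p hp => ⟨hp.1, ?_⟩⟩
  rw [mem_hypSegment_iff (mem_ball_zero_iff.1 hz.1) (mem_ball_zero_iff.1 hw.1)
    (mem_ball_zero_iff.1 hp.1)] at hp
  exact hC.segment_subset hz.2 hw.2 hp

/-! ### Chords and the circular arcs above them. -/

/-- The coordinate of `x` in the direction `e^{iψ}`. -/
noncomputable def normalCoord (x : ℂ) (ψ : ℝ) : ℝ := x.re * Real.cos ψ + x.im * Real.sin ψ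

/-- The coordinate of `x` in the direction `i e^{iψ}`. -/
noncomputable def tangentCoord (x : ℂ) (ψ : ℝ) : ℝ := x.im * Real.cos ψ - x.re * Real.sin ψ

/-- The radius of the circle cut out of the unit sphere by the vertical plane through `x` that is
orthogonal to `e^{iψ}`. -/
noncomputable def chordRadius (x : ℂ) (ψ : ℝ) : ℝ := √(1 - normalCoord x ψ ^ 2)

/-- The angular position of the lift of `x` on that circle. -/
noncomputable def chordAngle (x : ℂ) (ψ : ℝ) : ℝ :=
  Real.arcsin (tangentCoord x ψ / chordRadius x ψ)

/-- The signed arc length on that circle, measured from its top to the lift of `x`. -/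
noncomputable def chordArc (x : ℂ) (ψ : ℝ) : ℝ := chordRadius x ψ * chordAngle x ψ

theorem normalCoord_sq_add_tangentCoord_sq (x : ℂ) (ψ : ℝ) :
    normalCoord x ψ ^ 2 + tangentCoord x ψ ^ 2 = ‖x‖ ^ 2 := by
  rw [norm_sq_eq_re_im, normalCoord, tangentCoord]
  linear_combination (x.re ^ 2 + x.im ^ 2) * Real.sin_sq_add_cos_sq ψ

theorem normalCoord_mul_add_tangentCoord_mul (x y : ℂ) (ψ : ℝ) :
    normalCoord x ψ * normalCoord y ψ + tangentCoord x ψ * tangentCoord y ψ =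
      x.re * y.re + x.im * y.im := by
  rw [normalCoord, tangentCoord, normalCoord, tangentCoord]
  linear_combination (x.re * y.re + x.im * y.im) * Real.sin_sq_add_cos_sq ψ

theorem abs_normalCoord_le (x : ℂ) (ψ : ℝ) : |normalCoord x ψ| ≤ ‖x‖ := by
  have h := normalCoord_sq_add_tangentCoord_sq x ψ
  exact abs_le_of_sq_le_sq (by nlinarith [sq_nonneg (tangentCoord x ψ)]) (norm_nonneg x)

theorem chordRadius_nonneg (x : ℂ) (ψ : ℝ) : 0 ≤ chordRadius x ψ := Real.sqrt_nonneg _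

theorem chordRadius_le_one (x : ℂ) (ψ : ℝ) : chordRadius x ψ ≤ 1 := by
  exact Real.sqrt_le_one.2 (by nlinarith [sq_nonneg (normalCoord x ψ)])

theorem chordRadius_sq {x : ℂ} (hx : ‖x‖ ≤ 1) (ψ : ℝ) :
    chordRadius x ψ ^ 2 = 1 - normalCoord x ψ ^ 2 := by
  apply Real.sq_sqrt
  nlinarith [normalCoord_sq_add_tangentCoord_sq x ψ, sq_nonneg (tangentCoord x ψ), norm_nonneg x]

theorem chordRadius_mul_sin {x : ℂ} (hx : ‖x‖ ≤ 1) (ψ : ℝ) :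
    chordRadius x ψ * Real.sin (chordAngle x ψ) = tangentCoord x ψ := by
  have h1 := chordRadius_sq hx ψ
  have h2 := normalCoord_sq_add_tangentCoord_sq x ψ
  have h3 : ‖x‖ ^ 2 ≤ 1 := by nlinarith [norm_nonneg x]
  have h4 : |tangentCoord x ψ| ≤ chordRadius x ψ :=
    abs_le_of_sq_le_sq (by linarith) (chordRadius_nonneg x ψ)
  rcases (chordRadius_nonneg x ψ).eq_or_lt with h | h
  · rw [← h] at h4 ⊢
    rw [zero_mul, abs_eq_zero.1 (le_antisymm h4 (abs_nonneg _))]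
  · have h5 : |tangentCoord x ψ / chordRadius x ψ| ≤ 1 := by
      rwa [abs_div, abs_of_pos h, div_le_one h]
    rw [chordAngle, Real.sin_arcsin (abs_le.1 h5).1 (abs_le.1 h5).2]
    field_simp

/-- The right side is the height of the lift of `x`, which does not depend on the direction of the
chord. -/
theorem chordRadius_mul_cos {x : ℂ} (hx : ‖x‖ ≤ 1) (ψ : ℝ) :
    chordRadius x ψ * Real.cos (chordAngle x ψ) = √(1 - ‖x‖ ^ 2) := by
  have h1 := chordRadius_sq hx ψ
  have h2 := normalCoord_sq_add_tangentCoord_sq x ψ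
  have h3 := chordRadius_mul_sin hx ψ
  have h4 : 0 ≤ Real.cos (chordAngle x ψ) := Real.cos_arcsin_nonneg _
  have h5 := Real.sin_sq_add_cos_sq (chordAngle x ψ)
  have h6 : (chordRadius x ψ * Real.sin (chordAngle x ψ)) ^ 2 = tangentCoord x ψ ^ 2 := by rw [h3]
  have h7 : 1 - ‖x‖ ^ 2 = (chordRadius x ψ * Real.cos (chordAngle x ψ)) ^ 2 := by
    linear_combination (-chordRadius x ψ ^ 2) * h5 + h6 - h1 + h2
  rw [h7, Real.sqrt_sq (mul_nonneg (chordRadius_nonneg x ψ) h4)]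

theorem sqrt_one_sub_norm_kleinMap_sq {z : ℂ} (hz : ‖z‖ ≤ 1) :
    √(1 - ‖kleinMap z‖ ^ 2) = kleinHeight z := by
  rw [norm_sq_eq_re_im, ← kleinHeight_sq, Real.sqrt_sq (kleinHeight_nonneg hz)]

/-- The spherical distance of two points above the same chord. -/
theorem sphDist_eq_of_chord {z w : ℂ} {p s a b : ℝ} {ψ : ℝ} (hs : 0 ≤ s) (hps : p ^ 2 + s ^ 2 = 1)
    (h1 : normalCoord (kleinMap z) ψ = p) (h2 : normalCoord (kleinMap w) ψ = p)
    (h3 : tangentCoord (kleinMap z) ψ = s * Real.sin a)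
    (h4 : tangentCoord (kleinMap w) ψ = s * Real.sin b)
    (h5 : kleinHeight z = s * Real.cos a) (h6 : kleinHeight w = s * Real.cos b) :
    sphDist z w = 2 * Real.arcsin (s * |Real.sin ((b - a) / 2)|) := by
  rw [sphDist]
  congr 2
  have hz : (0 : ℝ) < 1 + ‖z‖ ^ 2 := by positivity
  have hw : (0 : ℝ) < 1 + ‖w‖ ^ 2 := by positivity
  refine (pow_left_inj₀ (by positivity) (by positivity) two_ne_zero).1 ?_
  rw [div_pow, mul_pow, Real.sq_sqrt hz.le, Real.sq_sqrt hw.le, mul_pow, sq_abs]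
  have e1 : ‖z - w‖ ^ 2 = ‖z‖ ^ 2 + ‖w‖ ^ 2 - 2 * (z.re * w.re + z.im * w.im) := by
    simp only [norm_sq_eq_re_im, Complex.sub_re, Complex.sub_im]; ring
  have e2 := normalCoord_mul_add_tangentCoord_mul (kleinMap z) (kleinMap w) ψ
  have e3 : ‖z - w‖ ^ 2 / ((1 + ‖z‖ ^ 2) * (1 + ‖w‖ ^ 2)) =
      (1 - ((kleinMap z).re * (kleinMap w).re + (kleinMap z).im * (kleinMap w).im) -
        kleinHeight z * kleinHeight w) / 2 := by
    rw [e1, kleinMap_re, kleinMap_re, kleinMap_im, kleinMap_im, kleinHeight, kleinHeight]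
    field_simp
    ring
  have e4 : Real.sin ((b - a) / 2) ^ 2 =
      (1 - (Real.cos b * Real.cos a + Real.sin b * Real.sin a)) / 2 := by
    rw [← Real.cos_sub, Real.sin_sq_eq_half_sub, show 2 * ((b - a) / 2) = b - a by ring]
    ring
  rw [e3, ← e2, h1, h2, h3, h4, h5, h6, e4]
  linear_combination (-1 / 2) * hps

theorem mul_sin_le_sin_mul {s d : ℝ} (hs0 : 0 ≤ s) (hs1 : s ≤ 1) (hd0 : 0 ≤ d)
    (hd1 : d ≤ Real.pi) : s * Real.sin d ≤ Real.sin (s * d) := by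
  have := strictConcaveOn_sin_Icc.concaveOn.2 (x := d) ⟨hd0, hd1⟩ (y := 0)
    ⟨le_rfl, Real.pi_pos.le⟩ hs0 (sub_nonneg.2 hs1) (by ring)
  simpa using this

theorem arcsin_mul_sin_le {s d : ℝ} (hs0 : 0 ≤ s) (hs1 : s ≤ 1) (hd0 : 0 ≤ d)
    (hd1 : d ≤ Real.pi / 2) : Real.arcsin (s * Real.sin d) ≤ s * d := by
  have hpi := Real.pi_pos
  have h : s * d ≤ d := mul_le_of_le_one_left hd0 hs1
  have h0 : 0 ≤ s * d := mul_nonneg hs0 hd0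
  refine Real.arcsin_le_iff_le_sin ⟨?_, ?_⟩ ⟨by linarith, by linarith⟩ |>.2 ?_
  · nlinarith [mul_nonneg hs0 (Real.sin_nonneg_of_nonneg_of_le_pi hd0 (by linarith))]
  · nlinarith [Real.sin_le_one d]
  exact mul_sin_le_sin_mul hs0 hs1 hd0 (by linarith)

/-- Both lifts lie on one circle of radius `s`, at angular distance `2d`. The great-circle distance
`2 arcsin (s sin d)` is at most the arc `2 s d` by concavity of sine. -/
theorem sphDist_le_chordArc_sub {z w : ℂ} {ψ : ℝ} (hz : ‖z‖ ≤ 1) (hw : ‖w‖ ≤ 1)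
    (hn : normalCoord (kleinMap z) ψ = normalCoord (kleinMap w) ψ)
    (ht : tangentCoord (kleinMap z) ψ ≤ tangentCoord (kleinMap w) ψ) :
    sphDist z w ≤ chordArc (kleinMap w) ψ - chordArc (kleinMap z) ψ := by
  have hx := norm_kleinMap_le_one z
  have hy := norm_kleinMap_le_one w
  have hr : chordRadius (kleinMap w) ψ = chordRadius (kleinMap z) ψ := by
    rw [chordRadius, chordRadius, hn]
  have hs := chordRadius_nonneg (kleinMap z) ψ
  have hab : chordAngle (kleinMap z) ψ ≤ chordAngle (kleinMap w) ψ := by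
    rw [chordAngle, chordAngle, hr]
    exact Real.monotone_arcsin (div_le_div_of_nonneg_right ht hs)
  have e := sphDist_eq_of_chord hs
    (by linarith [chordRadius_sq hx ψ]) rfl hn.symm
    (chordRadius_mul_sin hx ψ).symm
    (by rw [← hr]; exact (chordRadius_mul_sin hy ψ).symm)
    (by rw [chordRadius_mul_cos hx, sqrt_one_sub_norm_kleinMap_sq hz])
    (by rw [← hr, chordRadius_mul_cos hy, sqrt_one_sub_norm_kleinMap_sq hw])
  have b1 := Real.neg_pi_div_two_le_arcsin
    (tangentCoord (kleinMap z) ψ / chordRadius (kleinMap z) ψ)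
  have b2 := Real.arcsin_le_pi_div_two
    (tangentCoord (kleinMap w) ψ / chordRadius (kleinMap w) ψ)
  rw [← chordAngle] at b1 b2
  have d0 : 0 ≤ (chordAngle (kleinMap w) ψ - chordAngle (kleinMap z) ψ) / 2 := by linarith
  have d1 : (chordAngle (kleinMap w) ψ - chordAngle (kleinMap z) ψ) / 2 ≤ Real.pi / 2 := by
    linarith
  rw [abs_of_nonneg (Real.sin_nonneg_of_nonneg_of_le_pi d0 (by linarith [Real.pi_pos]))] at e
  have := arcsin_mul_sin_le hs (chordRadius_le_one _ ψ) d0 d1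
  rw [e, chordArc, chordArc, hr]
  linarith

/-! ### Turning a chord about a point. -/

theorem hasDerivAt_normalCoord (x : ℂ) (ψ : ℝ) :
    HasDerivAt (normalCoord x) (tangentCoord x ψ) ψ := by
  have := ((Real.hasDerivAt_cos ψ).const_mul x.re).add ((Real.hasDerivAt_sin ψ).const_mul x.im)
  exact this.congr_deriv (by rw [tangentCoord]; ring)

theorem hasDerivAt_tangentCoord (x : ℂ) (ψ : ℝ) :
    HasDerivAt (tangentCoord x) (-normalCoord x ψ) ψ := by
  have := ((Real.hasDerivAt_cos ψ).const_mul x.im).sub ((Real.hasDerivAt_sin ψ).const_mul x.re)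
  exact this.congr_deriv (by rw [normalCoord]; ring)

/-- This factor governs the derivative of `chordArc`. Its maximum `π/2`, taken at `w = ±π/2`, is the
source of the constant `π²`. -/
theorem mul_sin_add_cos_le {w : ℝ} (h : |w| ≤ Real.pi / 2) :
    w * Real.sin w + Real.cos w ≤ Real.pi / 2 := by
  have aux : ∀ v : ℝ, 0 ≤ v → v ≤ Real.pi / 2 →
      v * Real.sin v + Real.cos v ≤ Real.pi / 2 := by
    intro v h0 h1
    have h2 : Real.cos v ≤ Real.pi / 2 - v := by
      rw [← Real.sin_pi_div_two_sub]
      exact Real.sin_le (by linarith)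
    nlinarith [Real.sin_le_one v]
  rcases abs_cases w with ⟨_, h0⟩ | ⟨_, h0⟩
  · exact aux w h0 (by linarith)
  · have := aux (-w) (by linarith) (by linarith)
    rw [Real.sin_neg, Real.cos_neg] at this
    linarith

theorem mul_sin_add_cos_nonneg {w : ℝ} (h : |w| ≤ Real.pi / 2) :
    0 ≤ w * Real.sin w + Real.cos w := by
  have h1 := Real.cos_nonneg_of_mem_Icc (abs_le.1 h)
  have hpi := Real.pi_pos
  have h2 : 0 ≤ w * Real.sin w := by
    rcases abs_cases w with ⟨_, h0⟩ | ⟨_, h0⟩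
    · exact mul_nonneg h0 (Real.sin_nonneg_of_nonneg_of_le_pi h0 (by linarith))
    · exact mul_nonneg_of_nonpos_of_nonpos h0.le
        (Real.sin_nonpos_of_nonpos_of_neg_pi_le h0.le (by linarith))
  linarith

theorem abs_chordAngle_le (x : ℂ) (ψ : ℝ) : |chordAngle x ψ| ≤ Real.pi / 2 :=
  abs_le.2 ⟨Real.neg_pi_div_two_le_arcsin _, Real.arcsin_le_pi_div_two _⟩

/-- Write `s`, `a`, `p` for radius, angle and normal coordinate. Since `s cos a` is constant and `(s
sin a)' = -p`, one gets `s' = -p sin a` and `s a' = -p cos a`. The condition `‖x‖ < 1` keeps `a`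
away from `±π/2`, where `arcsin` is not differentiable. -/
theorem hasDerivAt_chordArc {x : ℂ} (hx : ‖x‖ < 1) (ψ : ℝ) :
    HasDerivAt (chordArc x) (-normalCoord x ψ *
      (chordAngle x ψ * Real.sin (chordAngle x ψ) + Real.cos (chordAngle x ψ))) ψ := by
  have hx2 : 0 < 1 - ‖x‖ ^ 2 := by nlinarith [norm_nonneg x]
  have h2 := normalCoord_sq_add_tangentCoord_sq x ψ
  have hs2 := chordRadius_sq hx.le ψ
  have hpos : 0 < 1 - normalCoord x ψ ^ 2 := by nlinarith [sq_nonneg (tangentCoord x ψ)]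
  have hs : 0 < chordRadius x ψ := Real.sqrt_pos.2 hpos
  have hsin := chordRadius_mul_sin hx.le ψ
  have hcos := chordRadius_mul_cos hx.le ψ
  have hh : 0 < √(1 - ‖x‖ ^ 2) := Real.sqrt_pos.2 hx2
  have hc : 0 < Real.cos (chordAngle x ψ) := by
    rw [← hcos] at hh; exact (pos_iff_pos_of_mul_pos hh).1 hs
  have hu : Real.sin (chordAngle x ψ) = tangentCoord x ψ / chordRadius x ψ := by
    rw [← hsin]; field_simp
  have hsc := Real.sin_sq_add_cos_sq (chordAngle x ψ)
  have d1 : HasDerivAt (chordRadius x)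
      (-(normalCoord x ψ * tangentCoord x ψ / chordRadius x ψ)) ψ := by
    have := (((hasDerivAt_normalCoord x ψ).pow 2).const_sub 1).sqrt hpos.ne'
    refine this.congr_deriv ?_
    change _ / (2 * chordRadius x ψ) = _
    field_simp
    norm_num
    ring
  have d2 := (hasDerivAt_tangentCoord x ψ).div d1 hs.ne'
  have hlt : tangentCoord x ψ / chordRadius x ψ ≠ 1 := by
    rw [← hu]; intro h; rw [h] at hsc; nlinarith
  have hgt : tangentCoord x ψ / chordRadius x ψ ≠ -1 := by
    rw [← hu]; intro h; rw [h] at hsc; nlinarith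
  have d3 : HasDerivAt (chordAngle x) _ ψ := (Real.hasDerivAt_arcsin hgt hlt).comp ψ d2
  refine (d1.mul d3).congr_deriv ?_
  have e : √(1 - (tangentCoord x ψ / chordRadius x ψ) ^ 2) = Real.cos (chordAngle x ψ) := by
    rw [← hu, show 1 - Real.sin (chordAngle x ψ) ^ 2 = Real.cos (chordAngle x ψ) ^ 2 by linarith,
      Real.sqrt_sq hc.le]
  rw [e, ← hsin]
  field_simp
  linear_combination normalCoord x ψ * hsc

/-- On the unit circle the angle jumps between `±π/2`, but the radius vanishes at the jump, so the
product stays smooth. -/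
theorem chordArc_of_norm_eq_one {x : ℂ} (hx : ‖x‖ = 1) (ψ : ℝ) :
    chordArc x ψ = Real.pi / 2 * tangentCoord x ψ := by
  have h2 := normalCoord_sq_add_tangentCoord_sq x ψ
  have hr : chordRadius x ψ = |tangentCoord x ψ| := by
    rw [chordRadius, ← Real.sqrt_sq_eq_abs]
    congr 1
    rw [hx] at h2
    linarith
  rw [chordArc, chordAngle, hr]
  rcases lt_trichotomy (tangentCoord x ψ) 0 with h | h | h
  · rw [abs_of_neg h, div_neg, div_self h.ne, Real.arcsin_neg_one]; ring
  · rw [h]; simp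
  · rw [abs_of_pos h, div_self h.ne', Real.arcsin_one]; ring

theorem hasDerivAt_chordArc_lower {x : ℂ} (hx : ‖x‖ ≤ 1) (ψ : ℝ) :
    ∃ d, HasDerivAt (chordArc x) d ψ ∧ -(Real.pi / 2 * max (normalCoord x ψ) 0) ≤ d := by
  have hpi := Real.pi_pos
  rcases hx.lt_or_eq with h | h
  · refine ⟨_, hasDerivAt_chordArc h ψ, ?_⟩
    have h1 := mul_sin_add_cos_le (abs_chordAngle_le x ψ)
    have h2 := mul_sin_add_cos_nonneg (abs_chordAngle_le x ψ)
    have h3 := le_max_left (normalCoord x ψ) 0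
    have h4 := le_max_right (normalCoord x ψ) 0
    nlinarith [mul_le_mul_of_nonneg_right h3 h2, mul_le_mul_of_nonneg_left h1 h4]
  · refine ⟨Real.pi / 2 * -normalCoord x ψ, ?_, ?_⟩
    · rw [show chordArc x = fun ψ => Real.pi / 2 * tangentCoord x ψ from
        funext (chordArc_of_norm_eq_one h)]
      exact (hasDerivAt_tangentCoord x ψ).const_mul _
    · have h3 := le_max_left (normalCoord x ψ) 0
      nlinarith

/-- The arc length position of `x`, corrected so as to increase when the chord turns. -/
noncomputable def turnedArc (q : ℝ → ℝ) (x : ℂ) (ψ : ℝ) : ℝ :=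
  chordArc x ψ + Real.pi / 2 * ∫ t in (0 : ℝ)..ψ, q t

theorem monotone_turnedArc {q : ℝ → ℝ} (hq : Continuous q) (h0 : ∀ ψ, 0 ≤ q ψ) {x : ℂ}
    (hx : ‖x‖ ≤ 1) (hxq : ∀ ψ, normalCoord x ψ ≤ q ψ) : Monotone (turnedArc q x) := by
  choose d hd hd' using hasDerivAt_chordArc_lower hx
  have hD : ∀ ψ, HasDerivAt (turnedArc q x) (d ψ + Real.pi / 2 * q ψ) ψ := fun ψ =>
    (hd ψ).add (((hq.integral_hasStrictDerivAt 0 ψ).hasDerivAt).const_mul _)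
  refine monotone_of_deriv_nonneg (fun ψ => (hD ψ).differentiableAt) fun ψ => ?_
  rw [(hD ψ).deriv]
  have h1 : max (normalCoord x ψ) 0 ≤ q ψ := max_le (hxq ψ) (h0 ψ)
  have := mul_le_mul_of_nonneg_left h1 (by positivity : 0 ≤ Real.pi / 2)
  linarith [hd' ψ]

theorem normalCoord_sub (x y : ℂ) (ψ : ℝ) :
    normalCoord (y - x) ψ = normalCoord y ψ - normalCoord x ψ := by
  simp only [normalCoord, Complex.sub_re, Complex.sub_im]; ring

theorem tangentCoord_sub (x y : ℂ) (ψ : ℝ) :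
    tangentCoord (y - x) ψ = tangentCoord y ψ - tangentCoord x ψ := by
  simp only [tangentCoord, Complex.sub_re, Complex.sub_im]; ring

theorem normalCoord_rotate (x : ℂ) (ψ α : ℝ) :
    normalCoord x α =
      normalCoord x ψ * Real.cos (ψ - α) - tangentCoord x ψ * Real.sin (ψ - α) := by
  have h1 : Real.cos α = Real.cos ψ * Real.cos (ψ - α) + Real.sin ψ * Real.sin (ψ - α) := by
    rw [← Real.cos_sub]; congr 1; ring
  have h2 : Real.sin α = Real.sin ψ * Real.cos (ψ - α) - Real.cos ψ * Real.sin (ψ - α) := by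
    rw [← Real.sin_sub]; congr 1; ring
  rw [normalCoord, h1, h2, normalCoord, tangentCoord]
  ring

theorem continuous_normalCoord (x : ℂ) : Continuous (normalCoord x) := by
  unfold normalCoord; fun_prop

theorem continuous_normalCoord_left (ψ : ℝ) : Continuous fun x => normalCoord x ψ := by
  unfold normalCoord; fun_prop

theorem continuous_tangentCoord_left (ψ : ℝ) : Continuous fun x => tangentCoord x ψ := by
  unfold tangentCoord; fun_prop

theorem normalCoord_periodic (x : ℂ) : Function.Periodic (normalCoord x) (2 * Real.pi) := by
  intro ψ; simp [normalCoord]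

theorem tangentCoord_periodic (x : ℂ) : Function.Periodic (tangentCoord x) (2 * Real.pi) := by
  intro ψ; simp [tangentCoord]

theorem chordArc_periodic (x : ℂ) : Function.Periodic (chordArc x) (2 * Real.pi) := by
  intro ψ
  simp [chordArc, chordAngle, chordRadius, normalCoord_periodic x ψ, tangentCoord_periodic x ψ]

/-- The normal coordinate of `y - x` passes from nonpositive to nonpositive's opposite between `α`
and `β`, so it vanishes at some `ψ`. As `β - α < π`, the crossing is upward, which fixes the sign of
the tangential coordinate; only `α = β` needs the tie-break `ht`. -/
theorem exists_edge_direction {x y : ℂ} {α β : ℝ} (hαβ : α ≤ β) (hβ : β < α + Real.pi)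
    (hα : normalCoord y α ≤ normalCoord x α) (hβ' : normalCoord x β ≤ normalCoord y β)
    (ht : α = β → tangentCoord x α ≤ tangentCoord y α) :
    ∃ ψ ∈ Set.Icc α β, normalCoord x ψ = normalCoord y ψ ∧
      tangentCoord x ψ ≤ tangentCoord y ψ := by
  have h0 : (0 : ℝ) ∈ Set.Icc (normalCoord (y - x) α) (normalCoord (y - x) β) := by
    rw [normalCoord_sub, normalCoord_sub]; exact ⟨by linarith, by linarith⟩
  obtain ⟨ψ, hψ, h1⟩ := intermediate_value_Icc hαβ (continuous_normalCoord (y - x)).continuousOn h0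
  refine ⟨ψ, hψ, by rw [normalCoord_sub] at h1; linarith, ?_⟩
  by_contra hneg
  have h2 : tangentCoord (y - x) ψ < 0 := by rw [tangentCoord_sub]; linarith
  have h3 := h0.1
  have h4 := h0.2
  rw [normalCoord_rotate _ ψ, h1, zero_mul, zero_sub] at h3 h4
  have h5 : Real.sin (ψ - α) ≤ 0 := by nlinarith
  have h6 : 0 ≤ Real.sin (ψ - β) := by nlinarith
  have h7 : ψ = α := by
    by_contra hne
    have := lt_of_le_of_ne hψ.1 (Ne.symm hne)
    have := Real.sin_pos_of_pos_of_lt_pi (x := ψ - α) (by linarith) (by linarith [hψ.2])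
    linarith
  have h8 : ψ = β := by
    by_contra hne
    have := lt_of_le_of_ne hψ.2 hne
    have := Real.sin_neg_of_neg_of_neg_pi_lt (x := ψ - β) (by linarith) (by linarith [hψ.1])
    linarith
  have := ht (h7.symm.trans h8)
  rw [← h7] at this
  exact hneg this

/-- Turn about `z` from `α` to the edge direction `ψ`, slide along the edge to `w`, then turn to
`β`. Turning never decreases `turnedArc`, and at the common `ψ` the integral terms cancel. -/
theorem sphDist_le_turnedArc_sub {q : ℝ → ℝ} (hq : Continuous q) (h0 : ∀ ψ, 0 ≤ q ψ) {z w : ℂ}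
    (hz : ‖z‖ ≤ 1) (hw : ‖w‖ ≤ 1) (hzq : ∀ ψ, normalCoord (kleinMap z) ψ ≤ q ψ)
    (hwq : ∀ ψ, normalCoord (kleinMap w) ψ ≤ q ψ) {α β : ℝ} (hαβ : α ≤ β) (hβ : β < α + Real.pi)
    (hα : normalCoord (kleinMap w) α ≤ normalCoord (kleinMap z) α)
    (hβ' : normalCoord (kleinMap z) β ≤ normalCoord (kleinMap w) β)
    (ht : α = β → tangentCoord (kleinMap z) α ≤ tangentCoord (kleinMap w) α) :
    sphDist z w ≤ turnedArc q (kleinMap w) β - turnedArc q (kleinMap z) α := by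
  obtain ⟨ψ, hψ, h1, h2⟩ := exists_edge_direction hαβ hβ hα hβ' ht
  have h3 := sphDist_le_chordArc_sub hz hw h1 h2
  have h4 := monotone_turnedArc hq h0 (norm_kleinMap_le_one z) hzq hψ.1
  have h5 := monotone_turnedArc hq h0 (norm_kleinMap_le_one w) hwq hψ.2
  have h6 : turnedArc q (kleinMap w) ψ - turnedArc q (kleinMap z) ψ =
      chordArc (kleinMap w) ψ - chordArc (kleinMap z) ψ := by simp [turnedArc]
  linarith

/-! ### From pairwise distances to the length of the boundary. -/

theorem sphDist_nonneg (z w : ℂ) : 0 ≤ sphDist z w := by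
  rw [sphDist_eq_angle]; exact InnerProductGeometry.angle_nonneg _ _

theorem sphDist_comm (z w : ℂ) : sphDist z w = sphDist w z := by
  rw [sphDist_eq_angle, sphDist_eq_angle, InnerProductGeometry.angle_comm]

open MeasureTheory in
/-- A set is at most as long as an interval which contains an expanding image of it. -/
theorem hausdorffMeasure_image_le_of_dist_le {ι X : Type*} [MetricSpace X] [MeasurableSpace X]
    [BorelSpace X] (f : ι → X) (Φ : ι → ℝ) (A : Set ι) {m M : ℝ}
    (hd : ∀ i ∈ A, ∀ j ∈ A, dist (f i) (f j) ≤ |Φ i - Φ j|)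
    (hm : ∀ i ∈ A, m ≤ Φ i ∧ Φ i ≤ M) :
    Measure.hausdorffMeasure 1 (f '' A) ≤ ENNReal.ofReal (M - m) := by
  rcases A.eq_empty_or_nonempty with rfl | ⟨i₀, hi₀⟩
  · simp
  have : Nonempty ι := ⟨i₀⟩
  -- Inverting the expanding map `Φ` makes `f ∘ g` a 1-Lipschitz map from a subset of the interval
  -- onto a set covering `f '' A`.
  set g := Function.invFunOn Φ A with hg
  have hg1 : ∀ t ∈ Φ '' A, g t ∈ A := fun t ht => Function.invFunOn_mem ht
  have hg2 : ∀ t ∈ Φ '' A, Φ (g t) = t := fun t ht => Function.invFunOn_eq ht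
  have hL : LipschitzOnWith 1 (f ∘ g) (Φ '' A) := by
    refine LipschitzOnWith.of_dist_le_mul fun s hs t ht => ?_
    have := hd _ (hg1 s hs) _ (hg1 t ht)
    rw [hg2 s hs, hg2 t ht] at this
    simpa [Real.dist_eq] using this
  have hsub : f '' A ⊆ (f ∘ g) '' (Φ '' A) := by
    rintro _ ⟨i, hi, rfl⟩
    refine ⟨Φ i, ⟨i, hi, rfl⟩, ?_⟩
    have hi' : Φ i ∈ Φ '' A := ⟨i, hi, rfl⟩
    have := hd _ (hg1 _ hi') _ hi
    rw [hg2 _ hi', sub_self, abs_zero] at this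
    exact dist_le_zero.1 this
  calc Measure.hausdorffMeasure 1 (f '' A)
      ≤ Measure.hausdorffMeasure 1 ((f ∘ g) '' (Φ '' A)) := measure_mono hsub
    _ ≤ Measure.hausdorffMeasure 1 (Φ '' A) := by
        simpa using hL.hausdorffMeasure_image_le zero_le_one
    _ ≤ Measure.hausdorffMeasure 1 (Set.Icc m M) := by
        refine measure_mono ?_
        rintro _ ⟨i, hi, rfl⟩
        exact hm i hi
    _ = ENNReal.ofReal (M - m) := by rw [hausdorffMeasure_real, Real.volume_Icc]

theorem exists_normalCoord_eq (f : ℂ →ₗ[ℝ] ℝ) (hf : f ≠ 0) :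
    ∃ r > 0, ∃ ψ, ∀ y, f y = r * normalCoord y ψ := by
  have e : ∀ y : ℂ, f y = y.re * f 1 + y.im * f Complex.I := by
    intro y
    have : y = y.re • (1 : ℂ) + y.im • Complex.I := by
      simp [Complex.real_smul, Complex.re_add_im]
    conv_lhs => rw [this, map_add, map_smul, map_smul, smul_eq_mul, smul_eq_mul]
  set c : ℂ := ⟨f 1, f Complex.I⟩ with hc
  have hc0 : c ≠ 0 := by
    intro h
    apply hf
    have h1 : f 1 = 0 := congrArg Complex.re h
    have h2 : f Complex.I = 0 := congrArg Complex.im h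
    exact LinearMap.ext fun y => by rw [e, h1, h2]; simp
  refine ⟨‖c‖, norm_pos_iff.2 hc0, c.arg, fun y => ?_⟩
  have h1 : ‖c‖ * Real.cos c.arg = f 1 := by rw [Complex.norm_mul_cos_arg]
  have h2 : ‖c‖ * Real.sin c.arg = f Complex.I := by rw [Complex.norm_mul_sin_arg]
  rw [e, normalCoord, ← h1, ← h2]
  ring

/-- A planar convex set has a supporting half-plane at every point outside its interior. -/
theorem Convex.exists_normalCoord_le {C : Set ℂ} (hC : Convex ℝ C) {x : ℂ} (hx : x ∉ interior C) :
    ∃ ψ, ∀ y ∈ C, normalCoord y ψ ≤ normalCoord x ψ := by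
  suffices h : ∃ f : ℂ →ₗ[ℝ] ℝ, f ≠ 0 ∧ ∀ y ∈ C, f y ≤ f x by
    obtain ⟨f, hf, hfx⟩ := h
    obtain ⟨r, hr, ψ, hψ⟩ := exists_normalCoord_eq f hf
    refine ⟨ψ, fun y hy => ?_⟩
    have := hfx y hy
    rw [hψ, hψ] at this
    exact le_of_mul_le_mul_left this hr
  by_cases hi : (interior C).Nonempty
  · obtain ⟨f, hf⟩ := geometric_hahn_banach_open_point hC.interior isOpen_interior hx
    refine ⟨f, ?_, fun y hy => ?_⟩
    · intro h0
      obtain ⟨c, hc⟩ := hi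
      have h1 : ∀ v, f v = 0 := fun v => by
        change (f : ℂ →ₗ[ℝ] ℝ) v = 0; rw [h0]; rfl
      have := hf c hc
      rw [h1, h1] at this
      exact lt_irrefl _ this
    · have h1 : y ∈ closure (interior C) := by
        rw [hC.closure_interior_eq_closure_of_nonempty_interior hi]; exact subset_closure hy
      have h2 : closure (interior C) ⊆ {y | f y ≤ f x} :=
        closure_minimal (fun c hc => (hf c hc).le) (isClosed_le f.continuous continuous_const)
      exact h2 h1
  -- A nonempty convex set with empty interior lies in a line. A functional constant on it supports
  -- it, with the sign chosen by the side on which `x` lies.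
  · rcases C.eq_empty_or_nonempty with rfl | ⟨c, hc⟩
    · exact ⟨Complex.reLm, fun h => by simpa using LinearMap.congr_fun h 1, by simp⟩
    have h1 : affineSpan ℝ C ≠ ⊤ := fun h => hi (hC.interior_nonempty_iff_affineSpan_eq_top.2 h)
    have h2 : vectorSpan ℝ C < ⊤ := by
      rw [lt_top_iff_ne_top]
      intro h
      exact h1 ((AffineSubspace.affineSpan_eq_top_iff_vectorSpan_eq_top_of_nonempty ℝ ℂ ℂ
        ⟨c, hc⟩).2 h)
    obtain ⟨f, hf, hker⟩ := Submodule.exists_le_ker_of_lt_top _ h2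
    have h3 : ∀ y ∈ C, f y = f c := fun y hy => by
      have := hker (vsub_mem_vectorSpan ℝ hy hc)
      rw [LinearMap.mem_ker, vsub_eq_sub, map_sub] at this
      linarith
    rcases le_total (f c) (f x) with h | h
    · exact ⟨f, hf, fun y hy => by rw [h3 y hy]; exact h⟩
    · refine ⟨-f, neg_ne_zero.2 hf, fun y hy => ?_⟩
      simp only [LinearMap.neg_apply, h3 y hy]
      linarith

/-- A frontier point on the unit circle stays there, outside the open disc. At a frontier point
inside the disc, injectivity would pull an open part of the image back to a neighbourhood contained
in `E`. -/
theorem kleinMap_notMem_interior {E : Set ℂ} (hE : E ⊆ Metric.ball 0 1) {z : ℂ}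
    (hz : z ∈ frontier E) : kleinMap z ∉ interior (kleinMap '' E) := by
  intro hi
  have h1 : interior (kleinMap '' E) ⊆ Metric.ball 0 1 := by
    refine interior_subset.trans ?_
    rintro _ ⟨w, hw, rfl⟩
    exact mem_ball_zero_iff.2 (norm_kleinMap_lt_one (mem_ball_zero_iff.1 (hE hw)))
  have hz1 : ‖z‖ ≤ 1 := by
    have := closure_mono hE (frontier_subset_closure hz)
    exact mem_closedBall_zero_iff.1 (Metric.closure_ball_subset_closedBall this)
  have hz2 : ‖z‖ < 1 := by
    have h2 := mem_ball_zero_iff.1 (h1 hi)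
    have h3 := kleinHeight_sq z
    rw [← norm_sq_eq_re_im] at h3
    refine lt_of_le_of_ne hz1 fun h => ?_
    rw [kleinHeight, h] at h3
    norm_num at h3
    nlinarith [norm_nonneg (kleinMap z)]
  refine hz.2 (mem_interior.2 ⟨Metric.ball 0 1 ∩ kleinMap ⁻¹' interior (kleinMap '' E), ?_,
    Metric.isOpen_ball.inter (isOpen_interior.preimage continuous_kleinMap),
    mem_ball_zero_iff.2 hz2, hi⟩)
  rintro w ⟨hw1, hw2⟩
  obtain ⟨v, hv, hvw⟩ := interior_subset hw2
  have : v = w := by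
    rw [← kleinInv_kleinMap (mem_ball_zero_iff.1 (hE hv)).le, hvw,
      kleinInv_kleinMap (mem_ball_zero_iff.1 hw1).le]
  rwa [← this]

theorem exists_supporting_angle {E : Set ℂ} (hE : IsHypConvex E) {z : ℂ} (hz : z ∈ frontier E) :
    ∃ ψ ∈ Set.Ico 0 (2 * Real.pi), ∀ w ∈ closure E,
      normalCoord (kleinMap w) ψ ≤ normalCoord (kleinMap z) ψ := by
  obtain ⟨ψ, hψ⟩ := hE.convex_image.exists_normalCoord_le (kleinMap_notMem_interior hE.1 hz)
  refine ⟨toIcoMod Real.two_pi_pos 0 ψ, by simpa using toIcoMod_mem_Ico Real.two_pi_pos 0 ψ,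
    fun w hw => ?_⟩
  have e : ∀ x, normalCoord x (toIcoMod Real.two_pi_pos 0 ψ) = normalCoord x ψ := fun x =>
    (normalCoord_periodic x).sub_zsmul_eq _
  rw [e, e]
  have h2 : closure E ⊆ {w | normalCoord (kleinMap w) ψ ≤ normalCoord (kleinMap z) ψ} :=
    closure_minimal (fun c hc => hψ _ ⟨c, hc, rfl⟩)
      (isClosed_le ((continuous_normalCoord_left ψ).comp continuous_kleinMap) continuous_const)
  exact h2 hw

/-- The first point of the face of a compact set in a given direction. -/
theorem exists_face_start {K : Set ℂ} (hK : IsCompact K) (hne : K.Nonempty) (ψ : ℝ) :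
    ∃ v ∈ K, ∀ w ∈ K, normalCoord (kleinMap w) ψ ≤ normalCoord (kleinMap v) ψ ∧
      (normalCoord (kleinMap w) ψ = normalCoord (kleinMap v) ψ →
        tangentCoord (kleinMap v) ψ ≤ tangentCoord (kleinMap w) ψ) := by
  have c1 := (continuous_normalCoord_left ψ).comp continuous_kleinMap
  have c2 := (continuous_tangentCoord_left ψ).comp continuous_kleinMap
  obtain ⟨u, hu, hmax⟩ := hK.exists_isMaxOn hne c1.continuousOn
  have hF : IsCompact (K ∩ {w | normalCoord (kleinMap w) ψ = normalCoord (kleinMap u) ψ}) :=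
    hK.inter_right (isClosed_eq c1 continuous_const)
  obtain ⟨v, hv, hmin⟩ := hF.exists_isMinOn ⟨u, hu, rfl⟩ c2.continuousOn
  refine ⟨v, hv.1, fun w hw => ⟨?_, fun h => ?_⟩⟩
  · rw [hv.2]; exact hmax hw
  · exact hmin ⟨hw, h.trans hv.2⟩

/-- A spherical upper bound for the length of the boundary in terms of a majorant of the support
function of the Klein model. -/
theorem IsHypConvex.sphLength_frontier_le {E : Set ℂ} (hE : IsHypConvex E) {q : ℝ → ℝ}
    (hq : Continuous q) (h0 : ∀ ψ, 0 ≤ q ψ)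
    (hEq : ∀ z ∈ E, ∀ ψ, normalCoord (kleinMap z) ψ ≤ q ψ) :
    sphLength (frontier E) ≤ ENNReal.ofReal (Real.pi / 2 * ∫ t in (0 : ℝ)..2 * Real.pi, q t) := by
  have hpi := Real.pi_pos
  rcases E.eq_empty_or_nonempty with rfl | hne
  · simp [sphLength]
  have hcl : closure E ⊆ Metric.closedBall 0 1 :=
    (closure_mono hE.1).trans Metric.closure_ball_subset_closedBall
  have hK : IsCompact (closure E) :=
    (isCompact_closedBall (0 : ℂ) 1).of_isClosed_subset isClosed_closure hcl
  have hn : ∀ z ∈ closure E, ‖z‖ ≤ 1 := fun z hz => mem_closedBall_zero_iff.1 (hcl hz)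
  have hcq : ∀ z ∈ closure E, ∀ ψ, normalCoord (kleinMap z) ψ ≤ q ψ := by
    intro z hz ψ
    have h2 : closure E ⊆ {w | normalCoord (kleinMap w) ψ ≤ q ψ} :=
      closure_minimal (fun c hc => hEq c hc ψ)
        (isClosed_le ((continuous_normalCoord_left ψ).comp continuous_kleinMap) continuous_const)
    exact h2 hz
  have hN : ∀ z : ℂ, ∃ ψ, z ∈ frontier E → ψ ∈ Set.Ico 0 (2 * Real.pi) ∧ ∀ w ∈ closure E,
      normalCoord (kleinMap w) ψ ≤ normalCoord (kleinMap z) ψ := by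
    intro z
    by_cases hz : z ∈ frontier E
    · obtain ⟨ψ, h1, h2⟩ := exists_supporting_angle hE hz
      exact ⟨ψ, fun _ => ⟨h1, h2⟩⟩
    · exact ⟨0, fun h => absurd h hz⟩
  -- At a corner many directions support; any one choice works, since the comparison needs only
  -- support at each point.
  choose N hN using hN
  have hfr : ∀ z ∈ frontier E, z ∈ closure E := fun z hz => frontier_subset_closure hz
  -- Comparison requires directions less than `π` apart, hence the restriction to sectors. The first
  -- face point `v` breaks ties at the closed end `a`; at the open end `b` none can occur.
  have sector : ∀ a b : ℝ, b < a + Real.pi → ∀ v ∈ closure E, ∀ v' ∈ closure E,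
      (∀ w ∈ closure E, normalCoord (kleinMap w) a ≤ normalCoord (kleinMap v) a ∧
        (normalCoord (kleinMap w) a = normalCoord (kleinMap v) a →
          tangentCoord (kleinMap v) a ≤ tangentCoord (kleinMap w) a)) →
      (∀ w ∈ closure E, normalCoord (kleinMap w) b ≤ normalCoord (kleinMap v') b) →
      MeasureTheory.Measure.hausdorffMeasure 1
        (SphericalPlane.mk '' {z | z ∈ frontier E ∧ N z ∈ Set.Ico a b}) ≤
      ENNReal.ofReal (turnedArc q (kleinMap v') b - turnedArc q (kleinMap v) a) := by
    intro a b hab v hv v' hv' hva hvb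
    have base : ∀ z ∈ frontier E, ∀ w ∈ frontier E, N z ∈ Set.Ico a b → N w ∈ Set.Ico a b →
        (N z < N w ∨ N z = N w ∧ tangentCoord (kleinMap z) (N z) ≤
          tangentCoord (kleinMap w) (N w)) →
        sphDist z w ≤ turnedArc q (kleinMap w) (N w) - turnedArc q (kleinMap z) (N z) := by
      intro z hz w hw hza hwa h
      refine sphDist_le_turnedArc_sub hq h0 (hn z (hfr z hz)) (hn w (hfr w hw))
        (hcq z (hfr z hz)) (hcq w (hfr w hw)) ?_ ?_ ((hN z hz).2 w (hfr w hw))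
        ((hN w hw).2 z (hfr z hz)) ?_
      · rcases h with h | h
        · exact h.le
        · exact h.1.le
      · linarith [hza.1, hwa.2]
      · intro e
        rcases h with h | h
        · exact absurd e h.ne
        · have := h.2; rwa [← e] at this
    refine hausdorffMeasure_image_le_of_dist_le _ (fun z => turnedArc q (kleinMap z) (N z)) _
      ?_ ?_
    · rintro z ⟨hz, hza⟩ w ⟨hw, hwa⟩
      change sphDist z w ≤ _
      have tot : (N z < N w ∨ N z = N w ∧ tangentCoord (kleinMap z) (N z) ≤
            tangentCoord (kleinMap w) (N w)) ∨
          (N w < N z ∨ N w = N z ∧ tangentCoord (kleinMap w) (N w) ≤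
            tangentCoord (kleinMap z) (N z)) := by
        rcases lt_trichotomy (N z) (N w) with h | h | h
        · exact Or.inl (Or.inl h)
        · rcases le_total (tangentCoord (kleinMap z) (N z)) (tangentCoord (kleinMap w) (N w))
            with h' | h'
          · exact Or.inl (Or.inr ⟨h, h'⟩)
          · exact Or.inr (Or.inr ⟨h.symm, h'⟩)
        · exact Or.inr (Or.inl h)
      rcases tot with h | h
      · rw [abs_sub_comm]
        exact (base z hz w hw hza hwa h).trans (le_abs_self _)
      · rw [sphDist_comm]
        exact (base w hw z hz hwa hza h).trans (le_abs_self _)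
    · rintro z ⟨hz, hza⟩
      constructor
      · have := sphDist_le_turnedArc_sub hq h0 (hn v hv) (hn z (hfr z hz)) (hcq v hv)
          (hcq z (hfr z hz)) hza.1 (by linarith [hza.2]) (hva z (hfr z hz)).1
          ((hN z hz).2 v hv) (fun e => (hva z (hfr z hz)).2
            (le_antisymm (hva z (hfr z hz)).1 (by rw [e]; exact (hN z hz).2 v hv)))
        linarith [sphDist_nonneg v z]
      · have := sphDist_le_turnedArc_sub hq h0 (hn z (hfr z hz)) (hn v' hv') (hcq z (hfr z hz))
          (hcq v' hv') hza.2.le (by linarith [hza.1]) ((hN z hz).2 v' hv') (hvb z (hfr z hz))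
          (fun e => absurd e hza.2.ne)
        linarith [sphDist_nonneg z v']
  have hcne : (closure E).Nonempty := hne.closure
  obtain ⟨u, hu, hu'⟩ := exists_face_start hK hcne 0
  obtain ⟨v, hv, hv'⟩ := exists_face_start hK hcne (2 * Real.pi / 3)
  obtain ⟨w, hw, hw'⟩ := exists_face_start hK hcne (4 * Real.pi / 3)
  have hu2 : ∀ z ∈ closure E,
      normalCoord (kleinMap z) (2 * Real.pi) ≤ normalCoord (kleinMap u) (2 * Real.pi) := by
    intro z hz
    have := (hu' z hz).1
    rwa [← (normalCoord_periodic _).eq, ← (normalCoord_periodic (kleinMap u)).eq] at this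
  have s1 := sector 0 (2 * Real.pi / 3) (by linarith) u hu v hv hu' fun z hz => (hv' z hz).1
  have s2 := sector (2 * Real.pi / 3) (4 * Real.pi / 3) (by linarith) v hv w hw hv'
    fun z hz => (hw' z hz).1
  have s3 := sector (4 * Real.pi / 3) (2 * Real.pi) (by linarith) w hw u hu hw' hu2
  -- These three comparisons serve to show that the sector bounds are nonnegative, so that
  -- `ENNReal.ofReal` is additive on them.
  have d1 := sphDist_le_turnedArc_sub hq h0 (hn u hu) (hn v hv) (hcq u hu) (hcq v hv)
    (by positivity : 0 ≤ 2 * Real.pi / 3) (by linarith) (hu' v hv).1 (hv' u hu).1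
    (fun e => by linarith)
  have d2 := sphDist_le_turnedArc_sub hq h0 (hn v hv) (hn w hw) (hcq v hv) (hcq w hw)
    (by linarith : 2 * Real.pi / 3 ≤ 4 * Real.pi / 3) (by linarith) (hv' w hw).1 (hw' v hv).1
    (fun e => by linarith)
  have d3 := sphDist_le_turnedArc_sub hq h0 (hn w hw) (hn u hu) (hcq w hw) (hcq u hu)
    (by linarith : 4 * Real.pi / 3 ≤ 2 * Real.pi) (by linarith) (hw' u hu).1 (hu2 w hw)
    (fun e => by linarith)
  -- The sector bounds telescope around `u, v, w, u`; by periodicity of `chordArc` only the integral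
  -- remains.
  have tot : turnedArc q (kleinMap u) (2 * Real.pi) - turnedArc q (kleinMap u) 0 =
      Real.pi / 2 * ∫ t in (0 : ℝ)..2 * Real.pi, q t := by
    simp [turnedArc, (chordArc_periodic (kleinMap u)).eq]
  have cover : SphericalPlane.mk '' frontier E ⊆
      SphericalPlane.mk '' {z | z ∈ frontier E ∧ N z ∈ Set.Ico 0 (2 * Real.pi / 3)} ∪
      SphericalPlane.mk '' {z | z ∈ frontier E ∧
        N z ∈ Set.Ico (2 * Real.pi / 3) (4 * Real.pi / 3)} ∪
      SphericalPlane.mk '' {z | z ∈ frontier E ∧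
        N z ∈ Set.Ico (4 * Real.pi / 3) (2 * Real.pi)} := by
    rw [← Set.image_union, ← Set.image_union]
    refine Set.image_mono fun z hz => ?_
    have := (hN z hz).1
    rcases lt_or_ge (N z) (2 * Real.pi / 3) with h | h
    · exact Or.inl (Or.inl ⟨hz, this.1, h⟩)
    rcases lt_or_ge (N z) (4 * Real.pi / 3) with h' | h'
    · exact Or.inl (Or.inr ⟨hz, h, h'⟩)
    · exact Or.inr ⟨hz, h', this.2⟩
  have n1 := sphDist_nonneg u v
  have n2 := sphDist_nonneg v w
  have n3 := sphDist_nonneg w u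
  calc sphLength (frontier E)
      ≤ _ := MeasureTheory.measure_mono cover
    _ ≤ _ := MeasureTheory.measure_union_le _ _
    _ ≤ _ := add_le_add (MeasureTheory.measure_union_le _ _) le_rfl
    _ ≤ _ := add_le_add (add_le_add s1 s2) s3
    _ = _ := by
      rw [← ENNReal.ofReal_add (by linarith) (by linarith),
        ← ENNReal.ofReal_add (by linarith) (by linarith), ← tot]
      congr 1
      ring

/-! ### Strict inequality and convergence to the disc. -/

/-- A majorant of the support function of a subset of the unit disc that lies in a half-plane at
distance `r` from the origin. -/
noncomputable def cappedSupport (r t : ℝ) : ℝ := min 1 (r + |2 * Real.sin (t / 2)|)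

theorem continuous_cappedSupport (r : ℝ) : Continuous (cappedSupport r) := by
  unfold cappedSupport; fun_prop

theorem cappedSupport_nonneg {r : ℝ} (hr : 0 ≤ r) (t : ℝ) : 0 ≤ cappedSupport r t :=
  le_min zero_le_one (by positivity)

theorem cappedSupport_periodic (r : ℝ) : Function.Periodic (cappedSupport r) (2 * Real.pi) := by
  intro t
  rw [cappedSupport, cappedSupport, show (t + 2 * Real.pi) / 2 = t / 2 + Real.pi by ring,
    Real.sin_add_pi, mul_neg, abs_neg]

theorem integral_cappedSupport_lt {r : ℝ} (hr1 : r < 1) :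
    ∫ t in (0 : ℝ)..2 * Real.pi, cappedSupport r t < 2 * Real.pi := by
  have h := intervalIntegral.integral_lt_integral_of_continuousOn_of_le_of_exists_lt
    (f := cappedSupport r) (g := fun _ => 1) Real.two_pi_pos
    (continuous_cappedSupport r).continuousOn continuousOn_const (fun t _ => min_le_left _ _)
    ⟨0, ⟨le_rfl, Real.two_pi_pos.le⟩, by simp [cappedSupport, hr1]⟩
  simpa using h

/-- By the sum-to-product formulas, the change of normal coordinate is the tangential coordinate at
the mid-angle, at most `1` in absolute value, times `2 sin ((ψ - ψ₀)/2)`. -/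
theorem normalCoord_le_cappedSupport {x : ℂ} (hx : ‖x‖ ≤ 1) {r ψ₀ : ℝ}
    (h : normalCoord x ψ₀ ≤ r) (ψ : ℝ) : normalCoord x ψ ≤ cappedSupport r (ψ - ψ₀) := by
  refine le_min (((le_abs_self _).trans (abs_normalCoord_le x ψ)).trans hx) ?_
  have e : normalCoord x ψ - normalCoord x ψ₀ =
      tangentCoord x ((ψ + ψ₀) / 2) * (2 * Real.sin ((ψ - ψ₀) / 2)) := by
    rw [normalCoord, normalCoord, tangentCoord]
    linear_combination x.re * Real.cos_sub_cos ψ ψ₀ + x.im * Real.sin_sub_sin ψ ψ₀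
  have h1 : |tangentCoord x ((ψ + ψ₀) / 2)| ≤ 1 := by
    have := normalCoord_sq_add_tangentCoord_sq x ((ψ + ψ₀) / 2)
    refine abs_le_of_sq_le_sq ?_ zero_le_one
    nlinarith [sq_nonneg (normalCoord x ((ψ + ψ₀) / 2)), norm_nonneg x]
  have h2 : normalCoord x ψ - normalCoord x ψ₀ ≤ |2 * Real.sin ((ψ - ψ₀) / 2)| := by
    rw [e]
    refine (le_abs_self _).trans ?_
    rw [abs_mul]
    exact mul_le_of_le_one_left (abs_nonneg _) h1
  linarith

theorem IsHypConvex.sphLength_frontier_le_of_notMem {E : Set ℂ} (hE : IsHypConvex E) {w : ℂ}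
    (hw : w ∉ E) (hw1 : ‖w‖ < 1) {r : ℝ} (hr : ‖kleinMap w‖ ≤ r) :
    sphLength (frontier E) ≤
      ENNReal.ofReal (Real.pi / 2 * ∫ t in (0 : ℝ)..2 * Real.pi, cappedSupport r t) := by
  have hw2 : kleinMap w ∉ interior (kleinMap '' E) := by
    intro h
    obtain ⟨v, hv, hvw⟩ := interior_subset h
    have : v = w := by
      rw [← kleinInv_kleinMap (mem_ball_zero_iff.1 (hE.1 hv)).le, hvw, kleinInv_kleinMap hw1.le]
    exact hw (this ▸ hv)
  obtain ⟨ψ₀, hψ⟩ := hE.convex_image.exists_normalCoord_le hw2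
  have h1 := hE.sphLength_frontier_le (q := fun ψ => cappedSupport r (ψ - ψ₀))
    ((continuous_cappedSupport r).comp (continuous_id.sub continuous_const))
    (fun ψ => cappedSupport_nonneg ((norm_nonneg _).trans hr) _)
    (fun z hz ψ => normalCoord_le_cappedSupport (norm_kleinMap_le_one z)
      ((hψ _ ⟨z, hz, rfl⟩).trans
        (((le_abs_self _).trans (abs_normalCoord_le _ _)).trans hr)) ψ)
  have h2 : ∫ t in (0 : ℝ)..2 * Real.pi, cappedSupport r (t - ψ₀) =
      ∫ t in (0 : ℝ)..2 * Real.pi, cappedSupport r t := by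
    rw [intervalIntegral.integral_comp_sub_right (cappedSupport r) ψ₀]
    have := (cappedSupport_periodic r).intervalIntegral_add_eq (0 - ψ₀) 0
    rw [← zero_add (2 * Real.pi), ← this]
    congr 1
    ring
  rwa [h2] at h1

theorem sphDist_circle_le (a b : ℝ) :
    sphDist ⟨Real.cos a, Real.sin a⟩ ⟨Real.cos b, Real.sin b⟩ ≤ |a - b| := by
  have hn : ∀ t : ℝ, ‖(⟨Real.cos t, Real.sin t⟩ : ℂ)‖ ^ 2 = 1 := fun t => by
    rw [norm_sq_eq_re_im]; exact Real.cos_sq_add_sin_sq t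
  have hd : ‖(⟨Real.cos a, Real.sin a⟩ - ⟨Real.cos b, Real.sin b⟩ : ℂ)‖ =
      2 * |Real.sin ((a - b) / 2)| := by
    refine (pow_left_inj₀ (by positivity) (by positivity) two_ne_zero).1 ?_
    rw [norm_sq_eq_re_im, mul_pow, sq_abs, Real.sin_sq_eq_half_sub,
      show 2 * ((a - b) / 2) = a - b by ring, Real.cos_sub]
    simp only [Complex.sub_re, Complex.sub_im]
    linear_combination Real.cos_sq_add_sin_sq a + Real.cos_sq_add_sin_sq b
  have hs : √(1 + 1 : ℝ) * √(1 + 1) = 2 := by rw [Real.mul_self_sqrt] <;> norm_num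
  rw [sphDist, hn, hn, hd, hs, mul_div_assoc, mul_comm, mul_comm 2, div_mul_cancel₀ _ two_ne_zero]
  rcases le_total Real.pi |a - b| with h | h
  · linarith [Real.arcsin_le_pi_div_two |Real.sin ((a - b) / 2)|]
  · have e : |Real.sin ((a - b) / 2)| = 1 * Real.sin (|a - b| / 2) := by
      rw [one_mul, Real.abs_sin_eq_sin_abs_of_abs_le_pi, abs_div, abs_two]
      rw [abs_div, abs_two]
      linarith [Real.pi_pos]
    have := arcsin_mul_sin_le zero_le_one le_rfl (by positivity : 0 ≤ |a - b| / 2) (by linarith)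
    rw [e]
    linarith

theorem sphLength_sphere_le :
    sphLength (Metric.sphere 0 1) ≤ ENNReal.ofReal (2 * Real.pi) := by
  have h := hausdorffMeasure_image_le_of_dist_le
    (fun t : ℝ => SphericalPlane.mk ⟨Real.cos t, Real.sin t⟩) id (Set.Icc (-Real.pi) Real.pi)
    (m := -Real.pi) (M := Real.pi) (fun a _ b _ => sphDist_circle_le a b) (fun a ha => ha)
  rw [show Real.pi - -Real.pi = 2 * Real.pi by ring] at h
  refine (MeasureTheory.measure_mono ?_).trans h
  rintro _ ⟨z, hz, rfl⟩
  refine ⟨z.arg, ⟨(Complex.neg_pi_lt_arg z).le, Complex.arg_le_pi z⟩, ?_⟩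
  have hz1 : ‖z‖ = 1 := mem_sphere_zero_iff_norm.1 hz
  have h1 := Complex.norm_mul_cos_arg z
  have h2 := Complex.norm_mul_sin_arg z
  rw [hz1, one_mul] at h1 h2
  exact congrArg SphericalPlane.mk (Complex.ext h1 h2)

theorem pi_div_two_mul_integral_cappedSupport_lt {r : ℝ} (hr : r < 1) :
    ENNReal.ofReal (Real.pi / 2 * ∫ t in (0 : ℝ)..2 * Real.pi, cappedSupport r t) <
      ENNReal.ofReal (Real.pi ^ 2) := by
  rw [ENNReal.ofReal_lt_ofReal_iff (by positivity)]
  have := mul_lt_mul_of_pos_left (integral_cappedSupport_lt hr) Real.pi_div_two_pos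
  linarith

theorem IsHypConvex.sphLength_frontier_lt {E : Set ℂ} (hE : IsHypConvex E) :
    sphLength (frontier E) < ENNReal.ofReal (Real.pi ^ 2) := by
  by_cases h : ∃ w ∈ Metric.ball (0 : ℂ) 1, w ∉ E
  · obtain ⟨w, hw1, hw⟩ := h
    have hw1 := mem_ball_zero_iff.1 hw1
    exact (hE.sphLength_frontier_le_of_notMem hw hw1 le_rfl).trans_lt
      (pi_div_two_mul_integral_cappedSupport_lt (norm_kleinMap_lt_one hw1))
  · push Not at h
    -- No point is missing, so no half-plane is available; here the boundary is the equator, of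
    -- length at most `2π < π²`.
    have e : E = Metric.ball 0 1 := Set.Subset.antisymm hE.1 h
    rw [e, frontier_ball _ one_ne_zero]
    refine sphLength_sphere_le.trans_lt ?_
    rw [ENNReal.ofReal_lt_ofReal_iff (by positivity)]
    nlinarith [Real.pi_gt_three]

theorem eventually_subset_of_tendsto_sphLength {E : ℕ → Set ℂ} (hE : ∀ n, IsHypConvex (E n))
    (hlim : Filter.Tendsto (fun n => sphLength (frontier (E n))) Filter.atTop
      (𝓝 (ENNReal.ofReal (Real.pi ^ 2)))) {K : Set ℂ} (hK : IsCompact K)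
    (hK1 : K ⊆ Metric.ball (0 : ℂ) 1) : ∀ᶠ n in Filter.atTop, K ⊆ E n := by
  rcases K.eq_empty_or_nonempty with rfl | hne
  · simp
  -- The largest Klein norm on `K` yields one bound below `π²` valid for every `E n` that misses any
  -- point of `K`.
  obtain ⟨v, hv, hmax⟩ := hK.exists_isMaxOn hne (continuous_kleinMap.norm).continuousOn
  have hr := norm_kleinMap_lt_one (mem_ball_zero_iff.1 (hK1 hv))
  filter_upwards [hlim.eventually_const_lt (pi_div_two_mul_integral_cappedSupport_lt hr)]
    with n hn w hw
  by_contra hwn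
  exact absurd hn (not_lt.2 ((hE n).sphLength_frontier_le_of_notMem hwn
    (mem_ball_zero_iff.1 (hK1 hw)) (hmax hw)))

/-! ### Ideal polygons and the lower bound. -/

open MeasureTheory in
theorem ofReal_mul_hausdorffMeasure_le_image {X : Type*} [MetricSpace X] [MeasurableSpace X]
    [BorelSpace X] {f : ℝ → X} {A : Set ℝ} {κ : ℝ} (hκ : 0 < κ)
    (h : ∀ a ∈ A, ∀ b ∈ A, κ * |a - b| ≤ dist (f a) (f b)) :
    ENNReal.ofReal κ * volume A ≤ Measure.hausdorffMeasure 1 (f '' A) := by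
  set g := Function.invFunOn f A with hg
  have hg1 : ∀ t ∈ f '' A, g t ∈ A := fun t ht => Function.invFunOn_mem ht
  have hg2 : ∀ t ∈ f '' A, f (g t) = t := fun t ht => Function.invFunOn_eq ht
  have hL : LipschitzOnWith (Real.toNNReal κ⁻¹) g (f '' A) := by
    refine LipschitzOnWith.of_dist_le_mul fun s hs t ht => ?_
    have := h _ (hg1 s hs) _ (hg1 t ht)
    rw [hg2 s hs, hg2 t ht] at this
    rw [Real.coe_toNNReal _ (inv_pos.2 hκ).le, Real.dist_eq, inv_mul_eq_div, le_div_iff₀ hκ]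
    linarith
  have hsub : A ⊆ g '' (f '' A) := by
    intro a ha
    have ha' : f a ∈ f '' A := ⟨a, ha, rfl⟩
    refine ⟨f a, ha', ?_⟩
    have := h _ (hg1 _ ha') _ ha
    rw [hg2 _ ha', dist_self] at this
    have h3 : |g (f a) - a| ≤ 0 := by
      by_contra hneg
      push Not at hneg
      nlinarith [mul_pos hκ hneg]
    exact sub_eq_zero.1 (abs_nonpos_iff.1 h3)
  have h2 : volume A ≤ ENNReal.ofReal κ⁻¹ * Measure.hausdorffMeasure 1 (f '' A) := by
    rw [← hausdorffMeasure_real]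
    refine (measure_mono hsub).trans ?_
    simpa [ENNReal.ofReal] using hL.hausdorffMeasure_image_le zero_le_one
  calc ENNReal.ofReal κ * volume A
      ≤ ENNReal.ofReal κ * (ENNReal.ofReal κ⁻¹ * Measure.hausdorffMeasure 1 (f '' A)) := by gcongr
    _ = Measure.hausdorffMeasure 1 (f '' A) := by
      rw [← mul_assoc, ← ENNReal.ofReal_mul hκ.le, mul_inv_cancel₀ hκ.ne', ENNReal.ofReal_one,
        one_mul]

/-- The point of the Klein disc at distance `cos θ` from the origin in the direction `ψ`, and at
angle `a` on the semicircle of radius `sin θ` above its chord. -/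
noncomputable def chordPoint (θ ψ a : ℝ) : ℂ :=
  ⟨Real.cos θ * Real.cos ψ - Real.sin θ * Real.sin a * Real.sin ψ,
    Real.cos θ * Real.sin ψ + Real.sin θ * Real.sin a * Real.cos ψ⟩

theorem normalCoord_chordPoint (θ ψ a : ℝ) : normalCoord (chordPoint θ ψ a) ψ = Real.cos θ := by
  rw [normalCoord, chordPoint]
  linear_combination Real.cos θ * Real.sin_sq_add_cos_sq ψ

theorem tangentCoord_chordPoint (θ ψ a : ℝ) :
    tangentCoord (chordPoint θ ψ a) ψ = Real.sin θ * Real.sin a := by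
  rw [tangentCoord, chordPoint]
  linear_combination Real.sin θ * Real.sin a * Real.sin_sq_add_cos_sq ψ

theorem one_sub_norm_chordPoint_sq (θ ψ a : ℝ) :
    1 - ‖chordPoint θ ψ a‖ ^ 2 = (Real.sin θ * Real.cos a) ^ 2 := by
  rw [← normalCoord_sq_add_tangentCoord_sq _ ψ, normalCoord_chordPoint, tangentCoord_chordPoint]
  linear_combination -Real.sin_sq_add_cos_sq θ - Real.sin θ ^ 2 * Real.sin_sq_add_cos_sq a

theorem norm_chordPoint_lt_one {θ a : ℝ} (hθ : 0 < Real.sin θ) (ha : 0 < Real.cos a) (ψ : ℝ) :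
    ‖chordPoint θ ψ a‖ < 1 := by
  have := one_sub_norm_chordPoint_sq θ ψ a
  have h2 := pow_pos (mul_pos hθ ha) 2
  nlinarith [norm_nonneg (chordPoint θ ψ a)]

theorem kleinHeight_kleinInv {x : ℂ} (hx : ‖x‖ < 1) :
    kleinHeight (kleinInv x) = √(1 - ‖x‖ ^ 2) := by
  rw [← sqrt_one_sub_norm_kleinMap_sq (norm_kleinInv_lt_one hx).le, kleinMap_kleinInv hx.le]

theorem sphDist_chordPoint {θ a b : ℝ} (hθ : 0 < Real.sin θ) (ha : 0 < Real.cos a)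
    (hb : 0 < Real.cos b) (ψ : ℝ) :
    sphDist (kleinInv (chordPoint θ ψ a)) (kleinInv (chordPoint θ ψ b)) =
      2 * Real.arcsin (Real.sin θ * |Real.sin ((b - a) / 2)|) := by
  have hx := norm_chordPoint_lt_one hθ ha ψ
  have hy := norm_chordPoint_lt_one hθ hb ψ
  refine sphDist_eq_of_chord (p := Real.cos θ) (ψ := ψ) hθ.le (Real.cos_sq_add_sin_sq θ)
    ?_ ?_ ?_ ?_ ?_ ?_
  · rw [kleinMap_kleinInv hx.le, normalCoord_chordPoint]
  · rw [kleinMap_kleinInv hy.le, normalCoord_chordPoint]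
  · rw [kleinMap_kleinInv hx.le, tangentCoord_chordPoint]
  · rw [kleinMap_kleinInv hy.le, tangentCoord_chordPoint]
  · rw [kleinHeight_kleinInv hx, one_sub_norm_chordPoint_sq, Real.sqrt_sq (by positivity)]
  · rw [kleinHeight_kleinInv hy, one_sub_norm_chordPoint_sq, Real.sqrt_sq (by positivity)]

/-- The parametrization of the boundary arc of a half-plane in the spherical plane. -/
noncomputable def chordCurve (θ ψ a : ℝ) : SphericalPlane :=
  SphericalPlane.mk (kleinInv (chordPoint θ ψ a))

theorem dist_chordCurve {θ a b : ℝ} (hθ : 0 < Real.sin θ)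
    (ha : a ∈ Set.Ioo (-(Real.pi / 2)) (Real.pi / 2))
    (hb : b ∈ Set.Ioo (-(Real.pi / 2)) (Real.pi / 2)) (ψ : ℝ) :
    dist (chordCurve θ ψ a) (chordCurve θ ψ b) =
      2 * Real.arcsin (Real.sin θ * Real.sin (|a - b| / 2)) := by
  change sphDist (kleinInv (chordPoint θ ψ a)) (kleinInv (chordPoint θ ψ b)) = _
  rw [sphDist_chordPoint hθ (Real.cos_pos_of_mem_Ioo ha) (Real.cos_pos_of_mem_Ioo hb)]
  have hpi := Real.pi_pos
  have h : |b - a| < Real.pi := abs_lt.2 ⟨by linarith [ha.1, ha.2, hb.1, hb.2],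
    by linarith [ha.1, ha.2, hb.1, hb.2]⟩
  rw [Real.abs_sin_eq_sin_abs_of_abs_le_pi, abs_div, abs_two, abs_sub_comm]
  rw [abs_div, abs_two]
  linarith

theorem dist_chordCurve_le {θ a b : ℝ} (hθ : 0 < Real.sin θ)
    (ha : a ∈ Set.Ioo (-(Real.pi / 2)) (Real.pi / 2))
    (hb : b ∈ Set.Ioo (-(Real.pi / 2)) (Real.pi / 2)) (ψ : ℝ) :
    dist (chordCurve θ ψ a) (chordCurve θ ψ b) ≤ |a - b| := by
  rw [dist_chordCurve hθ ha hb]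
  have h : |a - b| < Real.pi := abs_lt.2 ⟨by linarith [ha.1, ha.2, hb.1, hb.2],
    by linarith [ha.1, ha.2, hb.1, hb.2]⟩
  have := arcsin_mul_sin_le hθ.le (Real.sin_le_one θ) (by positivity : 0 ≤ |a - b| / 2)
    (by linarith)
  nlinarith [Real.sin_le_one θ, abs_nonneg (a - b)]

/-- Concavity gives `sin t ≥ t sin d / d` on `[0, d]`; the loss factor `sin d / d` tends to `1` for
short pieces. -/
theorem le_dist_chordCurve {θ a b d : ℝ} (hθ : 0 < Real.sin θ)
    (ha : a ∈ Set.Ioo (-(Real.pi / 2)) (Real.pi / 2))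
    (hb : b ∈ Set.Ioo (-(Real.pi / 2)) (Real.pi / 2)) (hd0 : 0 < d) (hd : d ≤ Real.pi)
    (hab : |a - b| ≤ 2 * d) (ψ : ℝ) :
    Real.sin θ * (Real.sin d / d) * |a - b| ≤ dist (chordCurve θ ψ a) (chordCurve θ ψ b) := by
  rw [dist_chordCurve hθ ha hb]
  have hpi := Real.pi_pos
  have h1 := mul_sin_le_sin_mul (s := |a - b| / 2 / d) (by positivity)
    (by rw [div_le_one hd0]; linarith) hd0.le hd
  rw [div_mul_cancel₀ _ hd0.ne'] at h1
  have h2 : 0 ≤ Real.sin d := Real.sin_nonneg_of_nonneg_of_le_pi hd0.le hd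
  have h3 : 0 ≤ Real.sin (|a - b| / 2) := le_trans (by positivity) h1
  have h4 : Real.sin θ * Real.sin (|a - b| / 2) ≤ 1 :=
    mul_le_one₀ (Real.sin_le_one _) h3 (Real.sin_le_one _)
  have h5 : Real.sin θ * Real.sin (|a - b| / 2) ≤
      Real.arcsin (Real.sin θ * Real.sin (|a - b| / 2)) := by
    have h6 : 0 ≤ Real.sin θ * Real.sin (|a - b| / 2) := by positivity
    refine (Real.le_arcsin_iff_sin_le ⟨by linarith, by linarith [Real.pi_gt_three]⟩
      ⟨by linarith, h4⟩).2 (Real.sin_le h6)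
  have h7 := mul_le_mul_of_nonneg_left h1 hθ.le
  have e : Real.sin θ * (Real.sin d / d) * |a - b| =
      2 * (Real.sin θ * (|a - b| / 2 / d * Real.sin d)) := by field_simp
  rw [e]
  linarith

theorem injOn_chordCurve {θ : ℝ} (hθ : 0 < Real.sin θ) (ψ : ℝ) :
    Set.InjOn (chordCurve θ ψ) (Set.Ioo (-(Real.pi / 2)) (Real.pi / 2)) := by
  intro a ha b hb h
  have h1 := congrArg (fun z => kleinMap z.toComplex) h
  simp only [chordCurve] at h1
  rw [kleinMap_kleinInv (norm_chordPoint_lt_one hθ (Real.cos_pos_of_mem_Ioo ha) ψ).le,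
    kleinMap_kleinInv (norm_chordPoint_lt_one hθ (Real.cos_pos_of_mem_Ioo hb) ψ).le] at h1
  have h2 := tangentCoord_chordPoint θ ψ a
  rw [h1, tangentCoord_chordPoint] at h2
  exact Real.injOn_sin (Set.Ioo_subset_Icc_self ha) (Set.Ioo_subset_Icc_self hb)
    (mul_left_cancel₀ hθ.ne' h2).symm

theorem continuousOn_chordCurve {θ : ℝ} (hθ : 0 < Real.sin θ) (ψ : ℝ) :
    ContinuousOn (chordCurve θ ψ) (Set.Ioo (-(Real.pi / 2)) (Real.pi / 2)) := by
  have : LipschitzOnWith 1 (chordCurve θ ψ) (Set.Ioo (-(Real.pi / 2)) (Real.pi / 2)) :=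
    LipschitzOnWith.of_dist_le_mul fun a ha b hb => by
      simpa [Real.dist_eq] using dist_chordCurve_le hθ ha hb ψ
  exact this.continuousOn

/-- The hyperbolically convex region bounded by an ideal regular `n`-gon. -/
def idealPolygon (n : ℕ) : Set ℂ :=
  Metric.ball 0 1 ∩ kleinMap ⁻¹'
    {x | ∀ j < n, normalCoord x (2 * (Real.pi / n) * j) ≤ Real.cos (Real.pi / n)}

theorem isHypConvex_idealPolygon (n : ℕ) : IsHypConvex (idealPolygon n) := by
  refine isHypConvex_preimage fun x hx y hy a b ha hb hab j hj => ?_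
  have e : normalCoord (a • x + b • y) (2 * (Real.pi / n) * j) =
      a * normalCoord x (2 * (Real.pi / n) * j) + b * normalCoord y (2 * (Real.pi / n) * j) := by
    simp only [normalCoord, Complex.add_re, Complex.add_im, Complex.real_smul,
      Complex.re_ofReal_mul, Complex.im_ofReal_mul]
    ring
  rw [e]
  have h1 := mul_le_mul_of_nonneg_left (hx j hj) ha
  have h2 := mul_le_mul_of_nonneg_left (hy j hj) hb
  calc _ ≤ a * Real.cos (Real.pi / n) + b * Real.cos (Real.pi / n) := add_le_add h1 h2
    _ = Real.cos (Real.pi / n) := by rw [← add_mul, hab, one_mul]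

theorem abs_cos_le_cos_pi_div {n k j : ℕ} (hk : k < n) (hj : j < n) (hkj : k ≠ j) :
    |Real.cos (Real.pi / n * (k - j))| ≤ Real.cos (Real.pi / n) := by
  have hn : (0 : ℝ) < n := by exact_mod_cast (Nat.zero_le k).trans_lt hk
  have hpi := Real.pi_pos
  have hθ : 0 < Real.pi / n := by positivity
  have h1 : (1 : ℝ) ≤ |(k : ℝ) - j| := by
    have : (1 : ℤ) ≤ |(k : ℤ) - j| := Int.one_le_abs (by omega)
    exact_mod_cast this
  have h2 : |(k : ℝ) - j| ≤ n - 1 := by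
    have : |(k : ℤ) - j| ≤ n - 1 := abs_le.2 ⟨by omega, by omega⟩
    exact_mod_cast this
  rw [← Real.cos_abs, abs_mul, abs_of_pos hθ]
  have h3 : Real.pi / n ≤ Real.pi / n * |(k : ℝ) - j| := by nlinarith
  have h4 : Real.pi / n * |(k : ℝ) - j| ≤ Real.pi - Real.pi / n := by
    have : Real.pi / n * (n - 1) = Real.pi - Real.pi / n := by field_simp
    rw [← this]
    gcongr
  refine abs_le.2 ⟨?_, Real.cos_le_cos_of_nonneg_of_le_pi hθ.le (by linarith) h3⟩
  rw [← Real.cos_pi_sub]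
  exact Real.cos_le_cos_of_nonneg_of_le_pi (by positivity) (by linarith) h4

/-- Open sides lie strictly inside the other half-planes, so they are pairwise disjoint and belong
to the polygon. With `t` the tangential coordinate, the gap is `2 sin η (c sin η + t cos η)`,
positive because `|t cos η| < c s ≤ c |sin η|`. -/
theorem normalCoord_chordPoint_lt {n k j : ℕ} (hn : 3 ≤ n) (hk : k < n) (hj : j < n)
    (hkj : k ≠ j) {a : ℝ} (ha : 0 < Real.cos a) :
    normalCoord (chordPoint (Real.pi / n) (2 * (Real.pi / n) * k) a) (2 * (Real.pi / n) * j) <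
      Real.cos (Real.pi / n) := by
  have hpi := Real.pi_pos
  have hn' : (3 : ℝ) ≤ n := by exact_mod_cast hn
  have hθ : 0 < Real.pi / n := by positivity
  have hθ' : Real.pi / n < Real.pi / 2 := by
    apply div_lt_div_of_pos_left hpi <;> linarith
  have hc : 0 < Real.cos (Real.pi / n) := Real.cos_pos_of_mem_Ioo ⟨by linarith, hθ'⟩
  have hs : 0 < Real.sin (Real.pi / n) := Real.sin_pos_of_pos_of_lt_pi hθ (by linarith)
  have h1 := abs_cos_le_cos_pi_div hk hj hkj
  rw [normalCoord_rotate _ (2 * (Real.pi / n) * k), normalCoord_chordPoint,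
    tangentCoord_chordPoint, show 2 * (Real.pi / n) * (k : ℝ) - 2 * (Real.pi / n) * j =
      2 * (Real.pi / n * (k - j)) by ring, Real.cos_two_mul', Real.sin_two_mul]
  set η := Real.pi / n * ((k : ℝ) - j)
  set c := Real.cos (Real.pi / n)
  set s := Real.sin (Real.pi / n)
  have hcs : s ^ 2 + c ^ 2 = 1 := Real.sin_sq_add_cos_sq _
  have hη := Real.sin_sq_add_cos_sq η
  have h2 : s ≤ |Real.sin η| := by
    refine le_of_sq_le_sq ?_ (abs_nonneg _)
    rw [sq_abs]
    nlinarith [sq_abs (Real.cos η), abs_nonneg (Real.cos η)]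
  have h3 : |Real.sin a| < 1 := by
    refine abs_lt_of_sq_lt_sq ?_ zero_le_one
    nlinarith [Real.sin_sq_add_cos_sq a]
  have h4 : |s * Real.sin a * Real.cos η| < c * |Real.sin η| := by
    rw [abs_mul, abs_mul, abs_of_pos hs]
    calc s * |Real.sin a| * |Real.cos η| ≤ s * |Real.sin a| * c := by gcongr
      _ < s * 1 * c := by gcongr
      _ = c * s := by ring
      _ ≤ c * |Real.sin η| := by gcongr
  have h5 : 0 < |Real.sin η| := hs.trans_le h2
  have h6 : -(Real.sin η * (s * Real.sin a * Real.cos η)) < c * Real.sin η ^ 2 := by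
    calc -(Real.sin η * (s * Real.sin a * Real.cos η))
        ≤ |Real.sin η| * |s * Real.sin a * Real.cos η| := by
          rw [← abs_mul]; exact neg_le_abs _
      _ < |Real.sin η| * (c * |Real.sin η|) := by gcongr
      _ = c * Real.sin η ^ 2 := by rw [← sq_abs (Real.sin η)]; ring
  have h7 : Real.cos η ^ 2 = 1 - Real.sin η ^ 2 := by linarith
  rw [h7]
  nlinarith

theorem continuous_kleinInv : Continuous kleinInv := by
  have h : Continuous fun x : ℂ => (1 / (1 + √(1 - ‖x‖ ^ 2)) : ℝ) :=
    continuous_const.div (by fun_prop) fun x => by positivity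
  exact h.smul continuous_id

theorem kleinInv_chordPoint_mem_frontier {n k : ℕ} (hn : 3 ≤ n) (hk : k < n) {a : ℝ}
    (ha : 0 < Real.cos a) :
    kleinInv (chordPoint (Real.pi / n) (2 * (Real.pi / n) * k) a) ∈ frontier (idealPolygon n) := by
  have hpi := Real.pi_pos
  have hn' : (3 : ℝ) ≤ n := by exact_mod_cast hn
  have hθ : 0 < Real.pi / n := by positivity
  have hθ' : Real.pi / n < Real.pi / 2 := by
    apply div_lt_div_of_pos_left hpi <;> linarith
  have hc : 0 < Real.cos (Real.pi / n) := Real.cos_pos_of_mem_Ioo ⟨by linarith, hθ'⟩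
  have hs : 0 < Real.sin (Real.pi / n) := Real.sin_pos_of_pos_of_lt_pi hθ (by linarith)
  set x := chordPoint (Real.pi / n) (2 * (Real.pi / n) * k) a with hx
  have hx1 : ‖x‖ < 1 := norm_chordPoint_lt_one hs ha _
  constructor
  · refine subset_closure ⟨mem_ball_zero_iff.2 (norm_kleinInv_lt_one hx1), ?_⟩
    rw [Set.mem_preimage, kleinMap_kleinInv hx1.le]
    intro j hj
    by_cases h : k = j
    · rw [← h, hx, normalCoord_chordPoint]
    · exact (normalCoord_chordPoint_lt hn hk hj h ha).le
  · intro hi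
    -- Pushing the point radially outward violates the `k`-th inequality, because `cos (π/n) > 0`.
    have hcont : Continuous fun ε : ℝ => (1 + ε) • x := by fun_prop
    have h0 : (1 + (0 : ℝ)) • x = x := by simp
    have e1 : ∀ᶠ ε in 𝓝 (0 : ℝ), ‖(1 + ε) • x‖ < 1 :=
      hcont.norm.continuousAt.eventually_lt continuousAt_const (by rwa [h0])
    have e2 : ∀ᶠ ε in 𝓝 (0 : ℝ), kleinInv ((1 + ε) • x) ∈ interior (idealPolygon n) :=
      (continuous_kleinInv.comp hcont).continuousAt.eventually_mem
        (isOpen_interior.mem_nhds (by simpa using hi))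
    have e3 : ∀ᶠ ε in 𝓝[>] (0 : ℝ), 0 < ε := eventually_mem_nhdsWithin
    obtain ⟨ε, ⟨h1, h2⟩, h3⟩ :=
      (((e1.and e2).filter_mono nhdsWithin_le_nhds).and e3).exists
    have h4 := (interior_subset h2).2
    rw [Set.mem_preimage, kleinMap_kleinInv h1.le] at h4
    have h5 := h4 k hk
    have e : normalCoord ((1 + ε) • x) (2 * (Real.pi / n) * k) =
        (1 + ε) * normalCoord x (2 * (Real.pi / n) * k) := by
      simp only [normalCoord, Complex.real_smul, Complex.re_ofReal_mul, Complex.im_ofReal_mul]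
      ring
    rw [e, hx, normalCoord_chordPoint] at h5
    nlinarith

open MeasureTheory in
theorem le_sphLength_frontier_idealPolygon {n : ℕ} (hn : 3 ≤ n) :
    ENNReal.ofReal ((n * Real.sin (Real.pi / n)) * (n * (2 * Real.sin (Real.pi / 2 / n)))) ≤
      sphLength (frontier (idealPolygon n)) := by
  have hpi := Real.pi_pos
  have hn' : (3 : ℝ) ≤ n := by exact_mod_cast hn
  have hθ : 0 < Real.pi / n := by positivity
  have hθ' : Real.pi / n < Real.pi / 2 := by
    apply div_lt_div_of_pos_left hpi <;> linarith
  have hs : 0 < Real.sin (Real.pi / n) := Real.sin_pos_of_pos_of_lt_pi hθ (by linarith)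
  set d := Real.pi / 2 / n with hd
  have hd2 : Real.pi / n = 2 * d := by rw [hd]; ring
  have hd0 : 0 < d := by positivity
  have hdpi : d ≤ Real.pi := by linarith
  have hsd : 0 < Real.sin d := Real.sin_pos_of_pos_of_lt_pi hd0 (by linarith)
  have hdn : d * n = Real.pi / 2 := by rw [hd]; field_simp
  -- Each of the `n` semicircles is cut into `n` open pieces of angle `2d = π/n`, short enough for
  -- chordal estimates. The `n²` images are disjoint, and each has length at least `2 sin (π/n) sin
  -- d`.
  set I : Fin n → Set ℝ := fun j =>
    Set.Ioo (-(Real.pi / 2) + 2 * d * j) (-(Real.pi / 2) + 2 * d * (j + 1)) with hI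
  have hIsub : ∀ j, I j ⊆ Set.Ioo (-(Real.pi / 2)) (Real.pi / 2) := by
    intro j a ha
    have h1 : ((j : ℕ) : ℝ) + 1 ≤ n := by exact_mod_cast j.2
    have h0 : (0 : ℝ) ≤ ((j : ℕ) : ℝ) := Nat.cast_nonneg _
    refine ⟨lt_of_le_of_lt ?_ ha.1, lt_of_lt_of_le ha.2 ?_⟩
    · nlinarith
    · nlinarith
  set S : Fin n × Fin n → Set SphericalPlane := fun i =>
    chordCurve (Real.pi / n) (2 * (Real.pi / n) * (i.1 : ℕ)) '' I i.2 with hS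
  have hmeas : ∀ i, MeasurableSet (S i) := fun i =>
    measurableSet_Ioo.image_of_continuousOn_injOn
      ((continuousOn_chordCurve hs _).mono (hIsub _)) ((injOn_chordCurve hs _).mono (hIsub _))
  have hdisj : Pairwise (Function.onFun Disjoint S) := by
    rintro ⟨k, i⟩ ⟨l, j⟩ hne
    rw [Function.onFun, Set.disjoint_left]
    rintro _ ⟨a, ha, rfl⟩ ⟨b, hb, hab⟩
    have ha' := hIsub _ ha
    have hb' := hIsub _ hb
    have hca := Real.cos_pos_of_mem_Ioo ha'
    have hcb := Real.cos_pos_of_mem_Ioo hb'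
    by_cases hkl : k = l
    · subst hkl
      have e := injOn_chordCurve hs _ hb' ha' hab
      subst e
      have hij : (i : ℕ) ≠ j := fun h => hne (by rw [Fin.ext h])
      rcases lt_or_gt_of_ne hij with h | h
      · have : ((i : ℕ) : ℝ) + 1 ≤ (j : ℕ) := by exact_mod_cast h
        have h1 := ha.2
        have h2 := hb.1
        nlinarith
      · have : ((j : ℕ) : ℝ) + 1 ≤ (i : ℕ) := by exact_mod_cast h
        have h1 := ha.1
        have h2 := hb.2
        nlinarith
    · have h1 := congrArg (fun z => kleinMap z.toComplex) hab
      simp only [chordCurve] at h1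
      rw [kleinMap_kleinInv (norm_chordPoint_lt_one hs hcb _).le,
        kleinMap_kleinInv (norm_chordPoint_lt_one hs hca _).le] at h1
      have h2 := normalCoord_chordPoint_lt hn k.2 l.2 (fun h => hkl (Fin.ext h)) hca
      rw [← h1, normalCoord_chordPoint] at h2
      exact lt_irrefl _ h2
  have hlen : ∀ i, ENNReal.ofReal (Real.sin (Real.pi / n) * (2 * Real.sin d)) ≤
      Measure.hausdorffMeasure 1 (S i) := by
    intro i
    refine le_trans (le_of_eq ?_) (ofReal_mul_hausdorffMeasure_le_image
      (κ := Real.sin (Real.pi / n) * (Real.sin d / d)) (by positivity) fun a ha b hb =>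
        le_dist_chordCurve hs (hIsub _ ha) (hIsub _ hb) hd0 hdpi ?_ _)
    · rw [Real.volume_Ioo, ← ENNReal.ofReal_mul (by positivity)]
      congr 1
      field_simp
      ring
    · have := ha.1
      have := ha.2
      have := hb.1
      have := hb.2
      exact abs_le.2 ⟨by linarith, by linarith⟩
  have hsub : (⋃ i, S i) ⊆ SphericalPlane.mk '' frontier (idealPolygon n) := by
    refine Set.iUnion_subset ?_
    rintro ⟨k, j⟩ _ ⟨a, ha, rfl⟩
    exact ⟨_, kleinInv_chordPoint_mem_frontier hn k.2 (Real.cos_pos_of_mem_Ioo (hIsub _ ha)), rfl⟩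
  calc ENNReal.ofReal ((n * Real.sin (Real.pi / n)) * (n * (2 * Real.sin d)))
      = ∑ _i : Fin n × Fin n, ENNReal.ofReal (Real.sin (Real.pi / n) * (2 * Real.sin d)) := by
        rw [Finset.sum_const, Finset.card_univ, Fintype.card_prod, Fintype.card_fin, nsmul_eq_mul,
          ← ENNReal.ofReal_natCast, ← ENNReal.ofReal_mul (Nat.cast_nonneg _)]
        congr 1
        push_cast
        ring
    _ ≤ ∑ i, Measure.hausdorffMeasure 1 (S i) := Finset.sum_le_sum fun i _ => hlen i
    _ = Measure.hausdorffMeasure 1 (⋃ i, S i) := by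
        rw [measure_iUnion hdisj hmeas, tsum_fintype]
    _ ≤ sphLength (frontier (idealPolygon n)) := measure_mono hsub

theorem tendsto_nat_mul_sin_div (c : ℝ) :
    Filter.Tendsto (fun n : ℕ => (n : ℝ) * Real.sin (c / n)) Filter.atTop (𝓝 c) := by
  have h1 : Filter.Tendsto (fun n : ℕ => c * Real.sinc (c / n)) Filter.atTop (𝓝 c) := by
    have := (Real.continuous_sinc.tendsto 0).comp (tendsto_const_div_atTop_nhds_zero_nat c)
    simpa using this.const_mul c
  refine h1.congr' ?_
  filter_upwards [Filter.eventually_gt_atTop 0] with n hn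
  have hn' : (n : ℝ) ≠ 0 := by positivity
  by_cases hc : c = 0
  · simp [hc]
  · rw [Real.sinc_of_ne_zero (div_ne_zero hc hn')]
    field_simp

theorem tendsto_sphLength_frontier_idealPolygon :
    Filter.Tendsto (fun n => sphLength (frontier (idealPolygon n))) Filter.atTop
      (𝓝 (ENNReal.ofReal (Real.pi ^ 2))) := by
  have h1 : Filter.Tendsto (fun n : ℕ => ENNReal.ofReal
      ((n * Real.sin (Real.pi / n)) * (n * (2 * Real.sin (Real.pi / 2 / n))))) Filter.atTop
      (𝓝 (ENNReal.ofReal (Real.pi ^ 2))) := by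
    refine ENNReal.tendsto_ofReal ?_
    have := (tendsto_nat_mul_sin_div Real.pi).mul
      ((tendsto_nat_mul_sin_div (Real.pi / 2)).const_mul 2)
    rw [show Real.pi ^ 2 = Real.pi * (2 * (Real.pi / 2)) by ring]
    exact this.congr fun n => by ring
  -- The upper half of the squeeze is the general bound `π²` already proved for every hyperbolically
  -- convex set.
  refine tendsto_of_tendsto_of_tendsto_of_le_of_le' h1 tendsto_const_nhds ?_
    (Filter.Eventually.of_forall fun n => (isHypConvex_idealPolygon n).sphLength_frontier_lt.le)
  filter_upwards [Filter.eventually_ge_atTop 3] with n hn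
  exact le_sphLength_frontier_idealPolygon hn

theorem mainTheorem2 :
    (∀ E : Set ℂ, IsHypConvex E →
      sphLength (frontier E) < ENNReal.ofReal (Real.pi ^ 2)) ∧
    (∀ E : ℕ → Set ℂ, (∀ n, IsHypConvex (E n)) →
      Filter.Tendsto (fun n => sphLength (frontier (E n))) Filter.atTop
        (𝓝 (ENNReal.ofReal (Real.pi ^ 2))) →
      ∀ K : Set ℂ, IsCompact K → K ⊆ Metric.ball (0 : ℂ) 1 →
        ∀ᶠ n in Filter.atTop, K ⊆ E n) ∧
    (∃ E : ℕ → Set ℂ, (∀ n, IsHypConvex (E n)) ∧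
      Filter.Tendsto (fun n => sphLength (frontier (E n))) Filter.atTop
        (𝓝 (ENNReal.ofReal (Real.pi ^ 2)))) :=
  ⟨fun _ hE => hE.sphLength_frontier_lt,
    fun _ hE hlim _ hK hK1 => eventually_subset_of_tendsto_sphLength hE hlim hK hK1,
    idealPolygon, isHypConvex_idealPolygon, tendsto_sphLength_frontier_idealPolygon⟩
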